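/- **Decoration lemma.** Setting. Let $H$ be a group with a finite generating set $S$, and let $G$ be either its Cayley diagram (an edge oriented from $x$ to $xs$ and coloured by $s$, for all $x\in H$, $s\in S$) or its Cayley graph (unoriented uncoloured edges joining $x$ and $xs$). $\mathrm{Aut}(G)$ is the group of graph automorphisms, which for a diagram must preserve the orientations and colours of the edges. An $\mathrm{Aut}(G)$-invariant percolation is a random subgraph $\omega$ of $G$ whose law is invariant under $\mathrm{Aut}(G)$. Fix a vertex $o$. Decorated graphs. Let $K$ be a separable metric space (containing the edge colours, in the case of a diagram). Consider connected, locally finite rooted graphs $(\Gamma,o)$, decorated by extra vertices and extra edges such that the resulting graph is still connected and locally finite, together with a partial colouring of all vertices and edges by $K$ and a distinguished subgraph, up to rooted isomorphisms preserving all this structure. Two of them are at distance at most $1/r$ if there is a rooted isomorphism between the $r$-balls of the whole graphs which restricts to an isomorphism of the $r$-balls of the underlying rooted graphs, preserves the distinguished subgraph and the set of coloured vertices and edges, and changes the colours by at most $1/r$. An invariant property is a Borel set $\mathcal A$ of decorated graphs that is closed under moving the root to any other vertex of the underlying graph $\Gamma$ (not to extra vertices). Indistinguishability. Let $\Gamma$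 be the connected component of $o$ in $\omega$. If $\chi$ is a random partial colouring of $V(G)$ by $K$, view $(\Gamma,o)$ as a rooted graph decorated with the rest of $G$, with the subgraph $\omega$ and with the colouring $\chi$. The components of $\omega$, decorated with $G$, $\omega$ and $\chi$, are indistinguishable if this random decorated graph is ergodic: for every invariant property $\mathcal A$, either it is almost surely in $\mathcal A$ or it is almost surely not in $\mathcal A$. (If $\omega$ need not contain all vertices, this is meant conditionally on $o\in\omega$.) The components of $\omega$ are indistinguishable with scenery if this holds with no vertex coloured by $\chi$. Factor of iid. Let $\lambda=(\lambda(x))_{x\in V(G)}$ be iid uniform $[0,1]$ labels, independent of $\omega$. A factor of iid decoration on $(G,\omega)$ is a measurable $\delta(\omega,\lambda,x)\in K$ with $\delta(\gamma\omega,\gamma\lambda,\gamma x)=\delta(\omega,\lambda,x)$ for all $\gamma\in\mathrm{Aut}(G)$ and $x\in V(G)$. Lemma. Let $\omega$ be an $\mathrm{Aut}(G)$-invariant percolation on $G$ all of whose components are almost surely infinite, and suppose that its components are indistinguishable with scenery. Let $\delta$ be a factor of iid decoration on $(G,\omega)$. Then the components of $\omega$, decorated with $G$, $\omega$ and the colouring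 $x\mapsto\delta(\omega,\lambda,x)$, are indistinguishable. -/

import Mathlib

open MeasureTheory ProbabilityTheory

universe u v w

/-- A multigraph with vertex set `V` and edge set `E`, whose edges may be oriented or not, and
some of whose edges are coloured by elements of `K`. `G.Arc e x y` says that the edge `e` may be
traversed from `x` to `y` (respecting its orientation, if it is oriented). -/
structure Diagram (V E : Type u) (K : Type v) where
  Arc : E → V → V → Prop
  /-- An edge is either oriented from some `a` to some `b`, or is an unoriented edge `ab`. -/
  arc_ends : ∀ e, ∃ a b, (∀ x y, Arc e x y ↔ x = a ∧ y = b) ∨ (∀ x y, Arc e x y ↔ s(x, y) = s(a, b))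
  ecol : E → Option K

namespace Diagram

variable {V E V' E' V'' E'' : Type u} {K : Type v}

/-- Isomorphisms: bijections of the vertices and of the edges preserving incidence,
orientations and edge colours. -/
structure Iso (G : Diagram V E K) (G' : Diagram V' E' K) where
  onV : V ≃ V'
  onE : E ≃ E'
  arc : ∀ e x y, G'.Arc (onE e) (onV x) (onV y) ↔ G.Arc e x y
  ecol : ∀ e, G'.ecol (onE e) = G.ecol e

def Iso.refl (G : Diagram V E K) : G.Iso G where
  onV := Equiv.refl _
  onE := Equiv.refl _
  arc _ _ _ := Iff.rfl
  ecol _ := rfl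

def Iso.symm {G : Diagram V E K} {G' : Diagram V' E' K} (f : G.Iso G') : G'.Iso G where
  onV := f.onV.symm
  onE := f.onE.symm
  arc e x y := by rw [← f.arc]; simp
  ecol e := by rw [← f.ecol]; simp

def Iso.trans {G : Diagram V E K} {G' : Diagram V' E' K} {G'' : Diagram V'' E'' K}
    (f : G.Iso G') (g : G'.Iso G'') : G.Iso G'' where
  onV := f.onV.trans g.onV
  onE := f.onE.trans g.onE
  arc e x y := by simp [g.arc, f.arc]
  ecol e := by simp [g.ecol, f.ecol]

/-- The simple graph underlying the edges in `F`: distinct `x`, `y` are adjacent if some edge of `F`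
joins them (in either direction). -/
def skel (G : Diagram V E K) (F : Set E) : SimpleGraph V :=
  SimpleGraph.fromRel (fun x y => ∃ e ∈ F, G.Arc e x y)

/-- The vertices of the `r`-ball around `o` in the graph formed by the edges in `F`. -/
def ballV (G : Diagram V E K) (F : Set E) (o : V) (r : ℕ) : Set V :=
  {x | (G.skel F).edist o x ≤ r}

/-- The edges of the `r`-ball around `o` in the graph formed by the edges in `F`. -/
def ballE (G : Diagram V E K) (F : Set E) (o : V) (r : ℕ) : Set E :=
  {e ∈ F | ∀ x y, G.Arc e x y → x ∈ G.ballV F o r ∧ y ∈ G.ballV F o r}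

/-- Every vertex is incident to finitely many edges. -/
def LocFin (G : Diagram V E K) : Prop :=
  ∀ x, {e | ∃ y, G.Arc e x y ∨ G.Arc e y x}.Finite

/-- Subgraphs of `G`. -/
@[ext]
structure Sub (G : Diagram V E K) where
  verts : Set V
  edges : Set E
  ends_mem : ∀ e ∈ edges, ∀ x y, G.Arc e x y → x ∈ verts ∧ y ∈ verts

/-- The σ-algebra on the set of subgraphs generated by the events that a given vertex, or a given
edge, is in the subgraph. -/
instance (G : Diagram V E K) : MeasurableSpace G.Sub :=
  MeasurableSpace.comap (fun ω : G.Sub => (ω.verts, ω.edges)) inferInstance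

/-- The image of a subgraph under an automorphism. -/
def Iso.mapSub {G : Diagram V E K} (γ : G.Iso G) (ω : G.Sub) : G.Sub where
  verts := γ.onV '' ω.verts
  edges := γ.onE '' ω.edges
  ends_mem := by
    rintro _ ⟨e, he, rfl⟩ x y h
    obtain ⟨x, rfl⟩ := γ.onV.surjective x
    obtain ⟨y, rfl⟩ := γ.onV.surjective y
    have := ω.ends_mem e he x y ((γ.arc e x y).1 h)
    exact ⟨⟨x, this.1, rfl⟩, ⟨y, this.2, rfl⟩⟩

/-- The vertices of the connected component of `o` in the subgraph `ω`. -/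
def Sub.comp {G : Diagram V E K} (ω : G.Sub) (o : V) : Set V :=
  {x | (G.skel ω.edges).Reachable o x}

/-! ### Cayley graphs and Cayley diagrams -/

/-- The Cayley diagram of the group `H` with respect to `S`: for every `x ∈ H` and `s ∈ S` there is
an edge oriented from `x` to `x * s`, whose colour `c s` identifies `s`. -/
def cayleyDiagram (H : Type u) [Group H] (S : Finset H) (c : S ↪ K) : Diagram H (H × S) K where
  Arc e x y := x = e.1 ∧ y = e.1 * e.2
  arc_ends e := ⟨e.1, e.1 * e.2, Or.inl fun _ _ => Iff.rfl⟩
  ecol e := some (c e.2)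

/-- The Cayley graph of the group `H` with respect to `S`: unoriented, uncoloured edges joining
`x` and `x * s`. -/
def cayleyGraph (H : Type u) [Group H] (S : Finset H) (K : Type v) :
    Diagram H {e : Sym2 H // ∃ x, ∃ s ∈ S, e = s(x, x * s)} K where
  Arc e x y := s(x, y) = e.1
  arc_ends e := by
    obtain ⟨e, x, s, -, rfl⟩ := e
    exact ⟨x, x * s, Or.inr fun _ _ => Iff.rfl⟩
  ecol _ := none

/-- `G` is a Cayley graph or a Cayley diagram of a group with respect to a finite set of
generators. -/
def IsCayley (G : Diagram V E K) : Prop :=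
  ∃ (H : Type u) (_ : Group H) (S : Finset H), Subgroup.closure (S : Set H) = ⊤ ∧
    (Nonempty (G.Iso (cayleyGraph H S K)) ∨ ∃ c : S ↪ K, Nonempty (G.Iso (cayleyDiagram H S c)))

/-- A map carrying edges of the Cayley graph to edges of `G` and hitting all vertices shows that
`G` is connected. -/
theorem connected_of_cayley {H : Type u} [Group H] {S : Finset H}
    (hS : Subgroup.closure (S : Set H) = ⊤) (G : Diagram V E K) (f : H ≃ V)
    (hf : ∀ x, ∀ s ∈ S, ∃ e, G.Arc e (f x) (f (x * s))) : (G.skel Set.univ).Connected := by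
  have step : ∀ x, ∀ s ∈ S, (G.skel Set.univ).Reachable (f x) (f (x * s)) := by
    intro x s hs
    by_cases h : f x = f (x * s)
    · rw [← h]
    · obtain ⟨e, he⟩ := hf x s hs
      exact SimpleGraph.Adj.reachable (by
        rw [skel, SimpleGraph.fromRel_adj]
        exact ⟨h, Or.inl ⟨e, trivial, he⟩⟩)
  have key : ∀ g : H, ∀ x, (G.skel Set.univ).Reachable (f x) (f (x * g)) := by
    intro g
    have hg : g ∈ Subgroup.closure (S : Set H) := by rw [hS]; trivial
    induction hg using Subgroup.closure_induction with
    | mem s hs => exact fun x => step x s hs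
    | one => intro x; simp
    | mul a b _ _ ha hb =>
      intro x
      have := (ha x).trans (hb (x * a))
      rwa [mul_assoc] at this
    | inv a _ ha =>
      intro x
      have := (ha (x * a⁻¹)).symm
      simpa using this
  have : Nonempty V := ⟨f 1⟩
  refine SimpleGraph.Connected.mk fun a b => ?_
  have := key ((f.symm a)⁻¹ * f.symm b) (f.symm a)
  simpa using this

theorem IsCayley.connected {G : Diagram V E K} (hG : G.IsCayley) : (G.skel Set.univ).Connected := by
  obtain ⟨H, _, S, hS, ⟨⟨f⟩⟩ | ⟨c, ⟨f⟩⟩⟩ := hG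
  · refine connected_of_cayley hS G f.onV.symm fun x s hs => ?_
    refine ⟨f.onE.symm ⟨s(x, x * s), x, s, hs, rfl⟩, ?_⟩
    rw [← f.arc]
    simp [cayleyGraph]
  · refine connected_of_cayley hS G f.onV.symm fun x s hs => ?_
    refine ⟨f.onE.symm (x, ⟨s, hs⟩), ?_⟩
    rw [← f.arc]
    simp [cayleyDiagram]

theorem LocFin.of_iso {G : Diagram V E K} {G' : Diagram V' E' K} (f : G.Iso G') (h : G'.LocFin) :
    G.LocFin := by
  intro x
  refine Set.Finite.subset ((h (f.onV x)).preimage (f.onE.injective.injOn)) ?_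
  rintro e ⟨y, hy⟩
  exact ⟨f.onV y, by rwa [f.arc, f.arc]⟩

theorem IsCayley.locFin {G : Diagram V E K} (hG : G.IsCayley) : G.LocFin := by
  obtain ⟨H, _, S, hS, ⟨⟨f⟩⟩ | ⟨c, ⟨f⟩⟩⟩ := hG
  · refine LocFin.of_iso f fun x => ?_
    have hfin : ((fun s => s(x, x * s)) '' (S : Set H) ∪
        (fun s => s(x * s⁻¹, x)) '' (S : Set H)).Finite :=
      (S.finite_toSet.image _).union (S.finite_toSet.image _)
    refine Set.Finite.subset (hfin.preimage Subtype.val_injective.injOn) ?_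
    rintro ⟨e, z, s, hs, rfl⟩ ⟨y, hy⟩
    have hy' : s(x, y) = s(z, z * s) := by
      rcases hy with hy | hy
      · exact hy
      · rw [Sym2.eq_swap]; exact hy
    rcases Sym2.eq_iff.1 hy' with ⟨h1, h2⟩ | ⟨h1, h2⟩
    · exact Or.inl ⟨s, hs, by simp [h1]⟩
    · exact Or.inr ⟨s, hs, by simp [h1]⟩
  · refine LocFin.of_iso f fun x => ?_
    have hfin : (Set.range (fun s : S => (x, s)) ∪ Set.range (fun s : S => (x * (s : H)⁻¹, s))).Finite :=
      (Set.finite_range _).union (Set.finite_range _)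
    refine hfin.subset ?_
    rintro ⟨z, s⟩ ⟨y, ⟨h1, h2⟩ | ⟨h1, h2⟩⟩
    · exact Or.inl ⟨s, by simp_all⟩
    · exact Or.inr ⟨s, by simp_all⟩

end Diagram

/-! ### The space of decorated rooted graphs -/

/-- A rooted graph with a decoration. The rooted graph is `(core, root)`; it is connected. All other
vertices and edges of `graph` are the extra vertices and extra edges of the decoration. Colours: a
partial colouring `vcol`, `graph.ecol` of vertices and edges by `K`, together with a colour in
`{0, 1}` on every vertex and edge, recording a distinguished subgraph `mark` (so the colour space is
`{0, 1} × (K ∪ {none})`). The whole is connected and all degrees are finite. -/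
structure RDGraph (K : Type v) where
  V : Type u
  E : Type u
  graph : Diagram V E K
  vcol : V → Option K
  core : graph.Sub
  mark : graph.Sub
  root : V
  root_mem : root ∈ core.verts
  core_conn : ∀ x ∈ core.verts, (graph.skel core.edges).Reachable root x
  conn : (graph.skel Set.univ).Connected
  locFin : graph.LocFin

namespace RDGraph

variable {K : Type v}

/-- Equivalence of decorated rooted graphs: a rooted isomorphism preserving all the data. -/
def Equivalent (D D' : RDGraph.{u, v} K) : Prop :=
  ∃ f : D.graph.Iso D'.graph,
    f.onV D.root = D'.root ∧
    (∀ x, D'.vcol (f.onV x) = D.vcol x) ∧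
    (∀ x, f.onV x ∈ D'.core.verts ↔ x ∈ D.core.verts) ∧
    (∀ e, f.onE e ∈ D'.core.edges ↔ e ∈ D.core.edges) ∧
    (∀ x, f.onV x ∈ D'.mark.verts ↔ x ∈ D.mark.verts) ∧
    (∀ e, f.onE e ∈ D'.mark.edges ↔ e ∈ D.mark.edges)

theorem Equivalent.refl (D : RDGraph.{u, v} K) : D.Equivalent D :=
  ⟨Diagram.Iso.refl _, by simp [Diagram.Iso.refl]⟩

theorem Equivalent.symm {D D' : RDGraph.{u, v} K} (h : D.Equivalent D') : D'.Equivalent D := by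
  obtain ⟨f, h1, h2, h3, h4, h5, h6⟩ := h
  refine ⟨f.symm, ?_, fun x => ?_, fun x => ?_, fun x => ?_, fun x => ?_, fun x => ?_⟩
  · simp [Diagram.Iso.symm, ← h1]
  · simp [Diagram.Iso.symm, ← h2]
  · simp [Diagram.Iso.symm, ← h3]
  · simp [Diagram.Iso.symm, ← h4]
  · simp [Diagram.Iso.symm, ← h5]
  · simp [Diagram.Iso.symm, ← h6]

theorem Equivalent.trans {D D' D'' : RDGraph.{u, v} K} (h : D.Equivalent D')
    (h' : D'.Equivalent D'') : D.Equivalent D'' := by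
  obtain ⟨f, h1, h2, h3, h4, h5, h6⟩ := h
  obtain ⟨g, k1, k2, k3, k4, k5, k6⟩ := h'
  exact ⟨f.trans g, by simp [Diagram.Iso.trans, *]⟩

instance setoid (K : Type v) : Setoid (RDGraph.{u, v} K) where
  r := Equivalent
  iseqv := ⟨Equivalent.refl, Equivalent.symm, Equivalent.trans⟩

/-- Moving the root to another vertex of the underlying (undecorated) graph. -/
def reroot (D : RDGraph.{u, v} K) (x : D.V) (hx : x ∈ D.core.verts) : RDGraph.{u, v} K where
  V := D.V
  E := D.E
  graph := D.graph
  vcol := D.vcol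
  core := D.core
  mark := D.mark
  root := x
  root_mem := hx
  core_conn y hy := (D.core_conn x hx).symm.trans (D.core_conn y hy)
  conn := D.conn
  locFin := D.locFin

/-- `D` and `D'` are at distance at most `1 / r`: there is a rooted isomorphism between the `r`-balls
around the roots in the total graphs, which restricts to an isomorphism between the `r`-balls around
the roots in the underlying graphs, and changes the colours by at most `1 / r`. -/
def Close [Dist K] (r : ℕ) (D D' : RDGraph.{u, v} K) : Prop :=
  ∃ (f : D.graph.ballV Set.univ D.root r ≃ D'.graph.ballV Set.univ D'.root r)
    (g : D.graph.ballE Set.univ D.root r ≃ D'.graph.ballE Set.univ D'.root r),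
    (∀ x : D.graph.ballV Set.univ D.root r, (x : D.V) = D.root → (f x : D'.V) = D'.root) ∧
    (∀ e x y, D'.graph.Arc (g e : D'.E) (f x : D'.V) (f y : D'.V) ↔ D.graph.Arc e x y) ∧
    (∀ x, (f x : D'.V) ∈ D'.graph.ballV D'.core.edges D'.root r ↔
      (x : D.V) ∈ D.graph.ballV D.core.edges D.root r) ∧
    (∀ e, (g e : D'.E) ∈ D'.graph.ballE D'.core.edges D'.root r ↔
      (e : D.E) ∈ D.graph.ballE D.core.edges D.root r) ∧
    (∀ x, (f x : D'.V) ∈ D'.mark.verts ↔ (x : D.V) ∈ D.mark.verts) ∧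
    (∀ e, (g e : D'.E) ∈ D'.mark.edges ↔ (e : D.E) ∈ D.mark.edges) ∧
    (∀ x : D.graph.ballV Set.univ D.root r,
      Option.Rel (fun a b => dist a b ≤ 1 / (r : ℝ)) (D.vcol x) (D'.vcol (f x))) ∧
    (∀ e : D.graph.ballE Set.univ D.root r,
      Option.Rel (fun a b => dist a b ≤ 1 / (r : ℝ)) (D.graph.ecol e) (D'.graph.ecol (g e)))

end RDGraph

/-- The space of decorated rooted graphs up to equivalence. -/
def GDeco (K : Type v) : Type (max (u + 1) v) := Quotient (RDGraph.setoid.{u, v} K)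

namespace GDeco

variable {K : Type v}

/-- The equivalence class of a decorated rooted graph. -/
def mk (D : RDGraph.{u, v} K) : GDeco.{u, v} K := Quotient.mk _ D

/-- The topology of the local distance: `U` is open if with every point it contains all the points
at distance at most `1 / r`, for `r` large enough. -/
instance [Dist K] : TopologicalSpace (GDeco.{u, v} K) where
  IsOpen U := ∀ D, mk D ∈ U → ∃ R : ℕ, ∀ r ≥ R, ∀ D', D.Close r D' → mk D' ∈ U
  isOpen_univ _ _ := ⟨0, fun _ _ _ _ => trivial⟩
  isOpen_inter U U' h h' D hD := by
    obtain ⟨R, hR⟩ := h D hD.1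
    obtain ⟨R', hR'⟩ := h' D hD.2
    exact ⟨max R R', fun r hr D' hD' => ⟨hR r (le_of_max_le_left hr) D' hD',
      hR' r (le_of_max_le_right hr) D' hD'⟩⟩
  isOpen_sUnion s h D hD := by
    obtain ⟨U, hU, hDU⟩ := hD
    obtain ⟨R, hR⟩ := h U hU D hDU
    exact ⟨R, fun r hr D' hD' => ⟨U, hU, hR r hr D' hD'⟩⟩

instance [Dist K] : MeasurableSpace (GDeco.{u, v} K) := borel _

/-- An invariant property: a Borel set of decorated rooted graphs closed under moving the root
within the underlying graph. -/
def IsInvariantProperty [Dist K] (A : Set (GDeco.{u, v} K)) : Prop :=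
  MeasurableSet A ∧ ∀ (D : RDGraph.{u, v} K) (x : D.V) (hx : x ∈ D.core.verts),
    mk D ∈ A → mk (D.reroot x hx) ∈ A

end GDeco

namespace Diagram

variable {V E : Type u} {K : Type v}

/-- The component of `o` in the subgraph `ω` of `G`, rooted at `o` and decorated with `G`, with the
subgraph `ω`, and with the partial vertex colouring `χ` of `G`. -/
def decoratedComponent (G : Diagram V E K) (hG : G.IsCayley) (ω : G.Sub) (χ : V → Option K)
    (o : V) : RDGraph.{u, v} K where
  V := V
  E := E
  graph := G
  vcol := χ
  core :=
    { verts := ω.comp o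
      edges := {e ∈ ω.edges | ∃ x y, G.Arc e x y ∧ x ∈ ω.comp o}
      ends_mem := by
        rintro e ⟨he, a, b, hab, ha⟩ x y hxy
        have hadj : ∀ x y, G.Arc e x y → (G.skel ω.edges).Reachable x y := by
          intro x y h
          by_cases hne : x = y
          · rw [hne]
          · exact SimpleGraph.Adj.reachable (by
              rw [skel, SimpleGraph.fromRel_adj]
              exact ⟨hne, Or.inl ⟨e, he, h⟩⟩)
        have hx : x ∈ ω.comp o := by
          obtain ⟨p, q, h | h⟩ := G.arc_ends e
          · rw [((h x y).1 hxy).1, ← ((h a b).1 hab).1]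
            exact ha
          · have := (((h x y).1 hxy).trans ((h a b).1 hab).symm)
            rcases Sym2.eq_iff.1 this with ⟨h1, -⟩ | ⟨h1, -⟩
            · rw [h1]; exact ha
            · rw [h1]; exact SimpleGraph.Reachable.trans ha (hadj a b hab)
        exact ⟨hx, SimpleGraph.Reachable.trans hx (hadj x y hxy)⟩ }
  mark := ω
  root := o
  root_mem := SimpleGraph.Reachable.refl _
  core_conn := by
    intro x hx
    obtain ⟨p⟩ := (show (G.skel ω.edges).Reachable o x from hx)
    have key : ∀ {a b : V} (p : (G.skel ω.edges).Walk a b), a ∈ ω.comp o →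
        (G.skel {e ∈ ω.edges | ∃ x y, G.Arc e x y ∧ x ∈ ω.comp o}).Reachable a b := by
      intro a b p
      induction p with
      | nil => exact fun _ => SimpleGraph.Reachable.refl _
      | @cons a c b h p ih =>
        intro ha
        have hc : c ∈ ω.comp o := SimpleGraph.Reachable.trans ha h.reachable
        refine SimpleGraph.Reachable.trans (SimpleGraph.Adj.reachable ?_) (ih hc)
        rw [skel, SimpleGraph.fromRel_adj] at h ⊢
        obtain ⟨hne, ⟨e, he, h⟩ | ⟨e, he, h⟩⟩ := h
        · exact ⟨hne, Or.inl ⟨e, ⟨he, _, _, h, ha⟩, h⟩⟩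
        · exact ⟨hne, Or.inr ⟨e, ⟨he, _, _, h, hc⟩, h⟩⟩
    exact key p (SimpleGraph.Reachable.refl _)
  conn := hG.connected
  locFin := hG.locFin

/-- The components of the random subgraph `ω` of `G`, decorated with `G`, `ω` and the random partial
vertex colouring `χ`, are indistinguishable: the decorated component of `o` is ergodic, that is, it
has every invariant property with probability zero or one. (If `o ∉ ω` has positive probability,
this is understood conditionally on `o ∈ ω`.) -/
def Indistinguishable [Dist K] (G : Diagram V E K) (hG : G.IsCayley) {Ω : Type w}
    [MeasurableSpace Ω] (μ : Measure Ω) (o : V) (ω : Ω → G.Sub) (χ : Ω → V → Option K) : Prop :=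
  ∀ A : Set (GDeco.{u, v} K), GDeco.IsInvariantProperty A →
    (∀ᵐ t ∂μ, o ∈ (ω t).verts → GDeco.mk (G.decoratedComponent hG (ω t) (χ t) o) ∈ A) ∨
    (∀ᵐ t ∂μ, o ∈ (ω t).verts → GDeco.mk (G.decoratedComponent hG (ω t) (χ t) o) ∉ A)

/-- A factor of iid on `G` decorated with a subgraph `ω`: a function of `ω`, the labels and a vertex
that is measurable and is preserved by isomorphisms. -/
structure IsFactorOfIID [MeasurableSpace K] (G : Diagram V E K)
    (δ : G.Sub → (V → unitInterval) → V → K) : Prop where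
  measurable : ∀ x, Measurable fun p : G.Sub × (V → unitInterval) => δ p.1 p.2 x
  equivariant : ∀ (γ : G.Iso G) (ω : G.Sub) (l : V → unitInterval) (x : V),
    δ (γ.mapSub ω) (l ∘ γ.onV.symm) (γ.onV x) = δ ω l x

end Diagram

/-!
Let `A` be an invariant property, and let `p(ω)` be the conditional probability, given `ω`, that the
component of `o` decorated with `δ` is in `A`.

**Zero-one law.** If the component of `o` is infinite, then `p(ω)` is almost surely zero or one
(`ae_zero_or_one`). The event that the component is in `A` can be approximated by one that depends
on `ω` and on the labels in a finite set `F` (`exists_cylinder_approx`), so that, conditionally on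
`ω`, the error is small for most `ω`. Call a vertex good if the error is small after translating it
to `o`. By the mass transport principle, an infinite component almost surely contains no or
infinitely many good vertices (`ae_infinite_of_mem`). Hence if `o` is good there is a good vertex in
its component for which the translate of `F` is disjoint from `F`. Since `A` is invariant, moving the
root to this vertex does not change the event, which is thus approximated by two events that are
independent given `ω`. This forces `p(ω) ≈ p(ω)²` (`measureReal_le_sq_add`).

**The conditional probability as scenery.** The set of all `ω` with `p(ω) = 1` is measurable and is
preserved by automorphisms and by moving the root within the component. To apply the
indistinguishability with scenery, it has to be of the form "the component of `o`, without colours,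
is in `B`" for an invariant *Borel* property `B` (`Diagram.exists_invariantProperty`). The decorated
component depends continuously on `ω` (`Diagram.continuous_decoratedComponent`), and the space of
decorated graphs is Hausdorff: two decorated graphs with isomorphic balls of all radii are
isomorphic, by compactness (`RDGraph.equivalent_of_forall_localIso`). So the images of `{p = 1}` and
of its complement are disjoint analytic sets with compact union, and are Borel by the Lusin
separation theorem.

Indistinguishability with scenery thus shows that `p(ω) = 1` almost surely or `p(ω) ≠ 1` almost
surely on `o ∈ ω`. In the latter case `p(ω) = 0` by the zero-one law.
-/

/-! ### Balls in locally finite diagrams -/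

namespace Diagram

variable {V E : Type u} {K : Type v} {G : Diagram V E K} {F : Set E} {o x : V} {r s : ℕ}

theorem exists_arc (G : Diagram V E K) (e : E) : ∃ a b, G.Arc e a b := by
  obtain ⟨a, b, h | h⟩ := G.arc_ends e
  · exact ⟨a, b, (h a b).2 ⟨rfl, rfl⟩⟩
  · exact ⟨a, b, (h a b).2 rfl⟩

theorem Arc.ends {e : E} {a b x y : V} (hab : G.Arc e a b) (hxy : G.Arc e x y) :
    (x = a ∧ y = b) ∨ (x = b ∧ y = a) := by
  obtain ⟨p, q, h | h⟩ := G.arc_ends e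
  · obtain ⟨rfl, rfl⟩ := (h a b).1 hab
    exact Or.inl ((h x y).1 hxy)
  · have := ((h x y).1 hxy).trans ((h a b).1 hab).symm
    exact Sym2.eq_iff.1 this

theorem mem_ballV_iff_walk :
    x ∈ G.ballV F o r ↔ ∃ p : (G.skel F).Walk o x, p.length ≤ r := by
  constructor
  · intro h
    have hne : (G.skel F).edist o x ≠ ⊤ := fun h' => by simp [ballV, h'] at h
    obtain ⟨p, hp⟩ := SimpleGraph.exists_walk_of_edist_ne_top hne
    refine ⟨p, ?_⟩
    have : (p.length : ℕ∞) ≤ r := hp ▸ h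
    exact_mod_cast this
  · rintro ⟨p, hp⟩
    exact (SimpleGraph.edist_le p).trans (by exact_mod_cast hp)

theorem mem_ballV_zero : x ∈ G.ballV F o 0 ↔ x = o := by
  change (G.skel F).edist o x ≤ ((0 : ℕ) : ℕ∞) ↔ x = o
  rw [Nat.cast_zero, nonpos_iff_eq_zero, SimpleGraph.edist_eq_zero_iff, eq_comm]

theorem ballV_mono (h : r ≤ s) : G.ballV F o r ⊆ G.ballV F o s :=
  fun y (hy : (G.skel F).edist o y ≤ r) => hy.trans (Nat.cast_le.2 h)

theorem root_mem_ballV : o ∈ G.ballV F o r := by simp [ballV]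

theorem mem_ballV_succ : x ∈ G.ballV F o (r + 1) ↔
    x ∈ G.ballV F o r ∨ ∃ y ∈ G.ballV F o r, ∃ e ∈ F, G.Arc e y x ∨ G.Arc e x y := by
  constructor
  · rw [mem_ballV_iff_walk]
    rintro ⟨p, hp⟩
    rw [← p.length_reverse] at hp
    cases h : p.reverse with
    | nil => exact Or.inl root_mem_ballV
    | @cons _ y _ hadj q =>
      rw [h, SimpleGraph.Walk.length_cons] at hp
      right
      refine ⟨y, mem_ballV_iff_walk.2 ⟨q.reverse, by simpa using hp⟩, ?_⟩
      rw [skel, SimpleGraph.fromRel_adj] at hadj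
      obtain ⟨-, ⟨e, he, h⟩ | ⟨e, he, h⟩⟩ := hadj
      · exact ⟨e, he, Or.inr h⟩
      · exact ⟨e, he, Or.inl h⟩
  · rintro (h | ⟨y, hy, e, he, h⟩)
    · exact ballV_mono (Nat.le_succ r) h
    · by_cases hne : y = x
      · exact hne ▸ ballV_mono (Nat.le_succ r) hy
      obtain ⟨p, hp⟩ := mem_ballV_iff_walk.1 hy
      have hadj : (G.skel F).Adj y x := by
        rw [skel, SimpleGraph.fromRel_adj]
        exact ⟨hne, h.imp (fun h => ⟨e, he, h⟩) fun h => ⟨e, he, h⟩⟩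
      exact mem_ballV_iff_walk.2 ⟨p.concat hadj, by simpa using hp⟩

theorem ballV_mono_edges {F' : Set E} (h : F ⊆ F') : G.ballV F o r ⊆ G.ballV F' o r := by
  induction r with
  | zero => intro x hx; rwa [mem_ballV_zero] at hx ⊢
  | succ r ih =>
    intro x hx
    rw [mem_ballV_succ] at hx ⊢
    exact hx.imp (fun h => ih h) fun ⟨y, hy, e, he, h'⟩ => ⟨y, ih hy, e, h he, h'⟩

theorem reachable_iff_mem_ballV : (G.skel F).Reachable o x ↔ ∃ r, x ∈ G.ballV F o r := by
  constructor
  · rintro ⟨p⟩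
    exact ⟨p.length, mem_ballV_iff_walk.2 ⟨p, le_rfl⟩⟩
  · rintro ⟨r, h⟩
    obtain ⟨p, -⟩ := mem_ballV_iff_walk.1 h
    exact ⟨p⟩

theorem mem_ballE_of_arc {e : E} {a b : V} (he : e ∈ F) (h : G.Arc e a b)
    (ha : a ∈ G.ballV F o r) (hb : b ∈ G.ballV F o r) : e ∈ G.ballE F o r := by
  refine ⟨he, fun x y hxy => ?_⟩
  rcases h.ends hxy with ⟨rfl, rfl⟩ | ⟨rfl, rfl⟩
  exacts [⟨ha, hb⟩, ⟨hb, ha⟩]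

theorem ballE_mono (h : r ≤ s) : G.ballE F o r ⊆ G.ballE F o s :=
  fun _ he => ⟨he.1, fun x y hxy => ⟨ballV_mono h (he.2 x y hxy).1, ballV_mono h (he.2 x y hxy).2⟩⟩

theorem ballE_mono_edges {F' : Set E} (h : F ⊆ F') : G.ballE F o r ⊆ G.ballE F' o r :=
  fun _ he => ⟨h he.1, fun x y hxy =>
    ⟨ballV_mono_edges h (he.2 x y hxy).1, ballV_mono_edges h (he.2 x y hxy).2⟩⟩

theorem exists_mem_ballE {e : E} (he : e ∈ F)
    (h : ∀ x y, G.Arc e x y → (G.skel F).Reachable o x ∧ (G.skel F).Reachable o y) :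
    ∃ r, e ∈ G.ballE F o r := by
  obtain ⟨a, b, hab⟩ := G.exists_arc e
  obtain ⟨r, hr⟩ := reachable_iff_mem_ballV.1 (h a b hab).1
  obtain ⟨s, hs⟩ := reachable_iff_mem_ballV.1 (h a b hab).2
  exact ⟨max r s, mem_ballE_of_arc he hab (ballV_mono (le_max_left r s) hr)
    (ballV_mono (le_max_right r s) hs)⟩

theorem LocFin.finite_ballV (hG : G.LocFin) (F : Set E) (o : V) (r : ℕ) :
    (G.ballV F o r).Finite := by
  induction r with
  | zero => exact (Set.finite_singleton o).subset fun x hx => mem_ballV_zero.1 hx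
  | succ r ih =>
    have hends : ∀ e, {x | ∃ y, G.Arc e y x ∨ G.Arc e x y}.Finite := by
      intro e
      obtain ⟨a, b, hab⟩ := G.exists_arc e
      refine (Set.toFinite {a, b}).subset ?_
      rintro x ⟨y, h | h⟩ <;> rcases hab.ends h with h | h <;> simp [h.1, h.2]
    refine (ih.union (ih.biUnion fun y _ => (hG y).biUnion fun e _ => hends e)).subset ?_
    intro x hx
    rcases mem_ballV_succ.1 hx with hx | ⟨y, hy, e, -, h⟩
    · exact Or.inl hx
    · exact Or.inr (Set.mem_biUnion hy (Set.mem_biUnion (x := e) ⟨x, h⟩ ⟨y, h⟩))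

theorem LocFin.finite_ballE (hG : G.LocFin) (F : Set E) (o : V) (r : ℕ) :
    (G.ballE F o r).Finite := by
  refine ((hG.finite_ballV F o r).biUnion fun y _ => hG y).subset fun e he => ?_
  obtain ⟨a, b, hab⟩ := G.exists_arc e
  exact Set.mem_biUnion (he.2 a b hab).1 ⟨b, Or.inl hab⟩

theorem LocFin.countable_verts (hG : G.LocFin) (hc : (G.skel Set.univ).Connected) :
    Countable V := by
  obtain ⟨o⟩ := hc.nonempty
  rw [← Set.countable_univ_iff]
  refine (Set.countable_iUnion fun r => (hG.finite_ballV Set.univ o r).countable).mono ?_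
  intro x _
  exact Set.mem_iUnion.2 (reachable_iff_mem_ballV.1 (hc.preconnected o x))

theorem LocFin.countable_edges (hG : G.LocFin) (hc : (G.skel Set.univ).Connected) :
    Countable E := by
  have := hG.countable_verts hc
  rw [← Set.countable_univ_iff]
  refine (Set.countable_iUnion fun x => (hG x).countable).mono ?_
  intro e _
  obtain ⟨a, b, hab⟩ := G.exists_arc e
  exact Set.mem_iUnion.2 ⟨a, b, Or.inl hab⟩

/-- Every vertex joined to a vertex of a subgraph by its edges belongs to the subgraph. -/
theorem Sub.mem_verts_of_reachable {ω : G.Sub} (ho : o ∈ ω.verts)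
    (h : (G.skel ω.edges).Reachable o x) : x ∈ ω.verts := by
  obtain ⟨r, hr⟩ := reachable_iff_mem_ballV.1 h
  induction r generalizing x with
  | zero => rwa [mem_ballV_zero.1 hr]
  | succ r ih =>
    rcases mem_ballV_succ.1 hr with hr | ⟨y, -, e, he, h | h⟩
    · exact ih (reachable_iff_mem_ballV.2 ⟨r, hr⟩) hr
    · exact (ω.ends_mem e he _ _ h).2
    · exact (ω.ends_mem e he _ _ h).1

end Diagram

/-! ### Local isomorphisms -/

namespace Diagram

variable {V E V' E' : Type u} {K : Type v} {G : Diagram V E K} {G' : Diagram V' E' K}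
  {P : V → V' → Prop} {Q : E → E' → Prop} {F : Set E} {F' : Set E'} {o : V} {o' : V'} {r : ℕ}

/-- A relation between vertices and edges which respects arcs and the edge sets within the
`r`-balls does not increase distances to the root, up to `r`. -/
theorem mem_ballV_of_rel (hfun : ∀ x', P o x' → x' = o')
    (htot : ∀ x ∈ G.ballV F o r, ∃ x', P x x') (hE : ∀ e ∈ G.ballE F o r, ∃ e' ∈ F', Q e e')
    (harc : ∀ ⦃e e' x x' y y'⦄, Q e e' → P x x' → P y y' → G.Arc e x y → G'.Arc e' x' y') :
    ∀ s ≤ r, ∀ x x', P x x' → x ∈ G.ballV F o s → x' ∈ G'.ballV F' o' s := by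
  intro s
  induction s with
  | zero =>
    intro _ x x' hx h
    rw [mem_ballV_zero] at h ⊢
    exact hfun x' (h ▸ hx)
  | succ s ih =>
    intro hs x x' hx h
    rcases mem_ballV_succ.1 h with h' | ⟨y, hy, e, he, h'⟩
    · exact ballV_mono (Nat.le_succ s) (ih (by omega) x x' hx h')
    · have hyr := ballV_mono (show s ≤ r by omega) hy
      have hxr := ballV_mono hs h
      obtain ⟨y', hy'⟩ := htot y hyr
      have her : e ∈ G.ballE F o r := by
        rcases h' with h' | h'
        exacts [mem_ballE_of_arc he h' hyr hxr, mem_ballE_of_arc he h' hxr hyr]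
      obtain ⟨e', he', hee'⟩ := hE e her
      exact mem_ballV_succ.2 (Or.inr ⟨y', ih (by omega) y y' hy' hy, e', he',
        h'.imp (harc hee' hy' hx) (harc hee' hx hy')⟩)

theorem mem_ballE_of_rel {e : E} {e' : E'} {s : ℕ} (hQ : Q e e') (he' : e' ∈ F')
    (htot : ∀ x ∈ G.ballV F o s, ∃ x', P x x')
    (hV : ∀ x x', P x x' → x ∈ G.ballV F o s → x' ∈ G'.ballV F' o' s)
    (harc : ∀ ⦃e e' x x' y y'⦄, Q e e' → P x x' → P y y' → G.Arc e x y → G'.Arc e' x' y')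
    (he : e ∈ G.ballE F o s) : e' ∈ G'.ballE F' o' s := by
  obtain ⟨a, b, hab⟩ := G.exists_arc e
  obtain ⟨ha, hb⟩ := he.2 a b hab
  obtain ⟨a', ha'⟩ := htot a ha
  obtain ⟨b', hb'⟩ := htot b hb
  exact mem_ballE_of_arc he' (harc hQ ha' hb' hab) (hV a a' ha' ha) (hV b b' hb' hb)

theorem Iso.mem_ballV_iff (f : G.Iso G') (hF : ∀ e, f.onE e ∈ F' ↔ e ∈ F) {x : V} :
    f.onV x ∈ G'.ballV F' (f.onV o) r ↔ x ∈ G.ballV F o r := by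
  constructor
  · refine mem_ballV_of_rel (P := fun x' x => f.onV x = x') (Q := fun x' x => f.onE x = x')
      ?_ (fun x _ => f.onV.surjective x) ?_ ?_ r le_rfl _ _ rfl
    · exact fun x hx => f.onV.injective hx
    · intro e he
      obtain ⟨e, rfl⟩ := f.onE.surjective e
      exact ⟨e, (hF e).1 he.1, rfl⟩
    · rintro _ e _ x _ y rfl rfl rfl h
      exact (f.arc e x y).1 h
  · refine mem_ballV_of_rel (P := fun x x' => f.onV x = x') (Q := fun x x' => f.onE x = x')
      ?_ (fun x _ => ⟨_, rfl⟩) ?_ ?_ r le_rfl _ _ rfl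
    · exact fun x hx => hx.symm
    · exact fun e he => ⟨_, (hF e).2 he.1, rfl⟩
    · rintro e _ x _ y _ rfl rfl rfl h
      exact (f.arc e x y).2 h

theorem Iso.mem_ballE_iff (f : G.Iso G') (hF : ∀ e, f.onE e ∈ F' ↔ e ∈ F) {e : E} :
    f.onE e ∈ G'.ballE F' (f.onV o) r ↔ e ∈ G.ballE F o r := by
  refine and_congr (hF e) ⟨fun h x y hxy => ?_, fun h x' y' hxy => ?_⟩
  · rw [← f.mem_ballV_iff hF, ← f.mem_ballV_iff hF]
    exact h _ _ ((f.arc e x y).2 hxy)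
  · obtain ⟨x, rfl⟩ := f.onV.surjective x'
    obtain ⟨y, rfl⟩ := f.onV.surjective y'
    rw [f.mem_ballV_iff hF, f.mem_ballV_iff hF]
    exact h _ _ ((f.arc e x y).1 hxy)

end Diagram

namespace RDGraph

variable {K : Type v}

/-- `P` and `Q` are the graphs of partial bijections between the vertices, and between the edges,
of `D` and `D'` that are defined at least on the `r`-balls around the roots, preserve
the roots, the incidence relations, the distances to the roots up to `r` and the distinguished
subgraphs, and change the colours by at most `ε`. Relations are used instead of maps, so that
inverses, composites and limits are again of the same form. -/
structure LocalIso [Dist K] (r : ℕ) (ε : ℝ) (D D' : RDGraph.{u, v} K) (P : D.V → D'.V → Prop)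
    (Q : D.E → D'.E → Prop) : Prop where
  root : P D.root D'.root
  vtot : ∀ x ∈ D.graph.ballV Set.univ D.root r, ∃ x', P x x'
  vsurj : ∀ x' ∈ D'.graph.ballV Set.univ D'.root r, ∃ x, P x x'
  vfun : ∀ ⦃x x' x''⦄, P x x' → P x x'' → x' = x''
  vinj : ∀ ⦃x y x'⦄, P x x' → P y x' → x = y
  etot : ∀ e ∈ D.graph.ballE Set.univ D.root r, ∃ e', Q e e'
  esurj : ∀ e' ∈ D'.graph.ballE Set.univ D'.root r, ∃ e, Q e e'
  efun : ∀ ⦃e e' e''⦄, Q e e' → Q e e'' → e' = e''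
  einj : ∀ ⦃e f e'⦄, Q e e' → Q f e' → e = f
  arc : ∀ ⦃e e' x x' y y'⦄, Q e e' → P x x' → P y y' →
    (D'.graph.Arc e' x' y' ↔ D.graph.Arc e x y)
  ballV : ∀ s ≤ r, ∀ ⦃x x'⦄, P x x' →
    (x' ∈ D'.graph.ballV Set.univ D'.root s ↔ x ∈ D.graph.ballV Set.univ D.root s)
  ballE : ∀ s ≤ r, ∀ ⦃e e'⦄, Q e e' →
    (e' ∈ D'.graph.ballE Set.univ D'.root s ↔ e ∈ D.graph.ballE Set.univ D.root s)
  coreV : ∀ s ≤ r, ∀ ⦃x x'⦄, P x x' →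
    (x' ∈ D'.graph.ballV D'.core.edges D'.root s ↔ x ∈ D.graph.ballV D.core.edges D.root s)
  coreE : ∀ s ≤ r, ∀ ⦃e e'⦄, Q e e' →
    (e' ∈ D'.graph.ballE D'.core.edges D'.root s ↔ e ∈ D.graph.ballE D.core.edges D.root s)
  markV : ∀ ⦃x x'⦄, P x x' → (x' ∈ D'.mark.verts ↔ x ∈ D.mark.verts)
  markE : ∀ ⦃e e'⦄, Q e e' → (e' ∈ D'.mark.edges ↔ e ∈ D.mark.edges)
  vcol : ∀ ⦃x x'⦄, P x x' → Option.Rel (fun a b => dist a b ≤ ε) (D.vcol x) (D'.vcol x')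
  ecol : ∀ ⦃e e'⦄, Q e e' → Option.Rel (fun a b => dist a b ≤ ε) (D.graph.ecol e) (D'.graph.ecol e')

section

variable [PseudoMetricSpace K] {D D' D'' : RDGraph.{u, v} K} {r s : ℕ} {ε ε' : ℝ}
  {P : D.V → D'.V → Prop} {Q : D.E → D'.E → Prop}

theorem optionRel_mono (hε : ε ≤ ε') {a b : Option K}
    (h : Option.Rel (fun a b => dist a b ≤ ε) a b) : Option.Rel (fun a b => dist a b ≤ ε') a b := by
  cases h with
  | none => exact .none
  | some h => exact .some (h.trans hε)

theorem optionRel_symm {a b : Option K} (h : Option.Rel (fun a b => dist a b ≤ ε) a b) :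
    Option.Rel (fun a b => dist a b ≤ ε) b a := by
  cases h with
  | none => exact .none
  | some h => exact .some (by rwa [dist_comm])

theorem optionRel_trans {a b c : Option K} (h : Option.Rel (fun a b => dist a b ≤ ε) a b)
    (h' : Option.Rel (fun a b => dist a b ≤ ε') b c) :
    Option.Rel (fun a b => dist a b ≤ ε + ε') a c := by
  cases h with
  | none => cases h'; exact .none
  | some h => cases h' with | some h' => exact .some ((dist_triangle _ _ _).trans (add_le_add h h'))

theorem LocalIso.mono (h : LocalIso r ε D D' P Q) (hs : s ≤ r) : LocalIso s ε D D' P Q where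
  root := h.root
  vtot x hx := h.vtot x (Diagram.ballV_mono hs hx)
  vsurj x hx := h.vsurj x (Diagram.ballV_mono hs hx)
  vfun := h.vfun
  vinj := h.vinj
  etot e he := h.etot e (Diagram.ballE_mono hs he)
  esurj e he := h.esurj e (Diagram.ballE_mono hs he)
  efun := h.efun
  einj := h.einj
  arc := h.arc
  ballV t ht := h.ballV t (ht.trans hs)
  ballE t ht := h.ballE t (ht.trans hs)
  coreV t ht := h.coreV t (ht.trans hs)
  coreE t ht := h.coreE t (ht.trans hs)
  markV := h.markV
  markE := h.markE
  vcol := h.vcol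
  ecol := h.ecol

theorem LocalIso.weaken (h : LocalIso r ε D D' P Q) (hε : ε ≤ ε') : LocalIso r ε' D D' P Q :=
  { h with
    vcol _ _ a := optionRel_mono hε (h.vcol a)
    ecol _ _ a := optionRel_mono hε (h.ecol a) }

theorem LocalIso.symm (h : LocalIso r ε D D' P Q) : LocalIso r ε D' D (flip P) (flip Q) where
  root := h.root
  vtot := h.vsurj
  vsurj := h.vtot
  vfun _ _ _ a b := h.vinj a b
  vinj _ _ _ a b := h.vfun a b
  etot := h.esurj
  esurj := h.etot
  efun _ _ _ a b := h.einj a b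
  einj _ _ _ a b := h.efun a b
  arc _ _ _ _ _ _ a b c := (h.arc a b c).symm
  ballV t ht _ _ a := (h.ballV t ht a).symm
  ballE t ht _ _ a := (h.ballE t ht a).symm
  coreV t ht _ _ a := (h.coreV t ht a).symm
  coreE t ht _ _ a := (h.coreE t ht a).symm
  markV _ _ a := (h.markV a).symm
  markE _ _ a := (h.markE a).symm
  vcol _ _ a := optionRel_symm (h.vcol a)
  ecol _ _ a := optionRel_symm (h.ecol a)

theorem LocalIso.trans {P' : D'.V → D''.V → Prop} {Q' : D'.E → D''.E → Prop}
    (h : LocalIso r ε D D' P Q) (h' : LocalIso r ε' D' D'' P' Q') :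
    LocalIso r (ε + ε') D D'' (Relation.Comp P P') (Relation.Comp Q Q') where
  root := ⟨_, h.root, h'.root⟩
  vtot x hx := by
    obtain ⟨y, hy⟩ := h.vtot x hx
    obtain ⟨z, hz⟩ := h'.vtot y ((h.ballV r le_rfl hy).2 hx)
    exact ⟨z, y, hy, hz⟩
  vsurj z hz := by
    obtain ⟨y, hy⟩ := h'.vsurj z hz
    obtain ⟨x, hx⟩ := h.vsurj y ((h'.ballV r le_rfl hy).1 hz)
    exact ⟨x, y, hx, hy⟩
  vfun := by
    rintro x z z' ⟨y, h1, h2⟩ ⟨y', h3, h4⟩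
    obtain rfl := h.vfun h1 h3
    exact h'.vfun h2 h4
  vinj := by
    rintro x z z' ⟨y, h1, h2⟩ ⟨y', h3, h4⟩
    obtain rfl := h'.vinj h2 h4
    exact h.vinj h1 h3
  etot x hx := by
    obtain ⟨y, hy⟩ := h.etot x hx
    obtain ⟨z, hz⟩ := h'.etot y ((h.ballE r le_rfl hy).2 hx)
    exact ⟨z, y, hy, hz⟩
  esurj z hz := by
    obtain ⟨y, hy⟩ := h'.esurj z hz
    obtain ⟨x, hx⟩ := h.esurj y ((h'.ballE r le_rfl hy).1 hz)
    exact ⟨x, y, hx, hy⟩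
  efun := by
    rintro x z z' ⟨y, h1, h2⟩ ⟨y', h3, h4⟩
    obtain rfl := h.efun h1 h3
    exact h'.efun h2 h4
  einj := by
    rintro x z z' ⟨y, h1, h2⟩ ⟨y', h3, h4⟩
    obtain rfl := h'.einj h2 h4
    exact h.einj h1 h3
  arc := by
    rintro e e' x x' y y' ⟨_, a, a'⟩ ⟨_, b, b'⟩ ⟨_, c, c'⟩
    exact (h'.arc a' b' c').trans (h.arc a b c)
  ballV := by rintro t ht _ _ ⟨_, a, b⟩; exact (h'.ballV t ht b).trans (h.ballV t ht a)
  ballE := by rintro t ht _ _ ⟨_, a, b⟩; exact (h'.ballE t ht b).trans (h.ballE t ht a)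
  coreV := by rintro t ht _ _ ⟨_, a, b⟩; exact (h'.coreV t ht b).trans (h.coreV t ht a)
  coreE := by rintro t ht _ _ ⟨_, a, b⟩; exact (h'.coreE t ht b).trans (h.coreE t ht a)
  markV := by rintro _ _ ⟨_, a, b⟩; exact (h'.markV b).trans (h.markV a)
  markE := by rintro _ _ ⟨_, a, b⟩; exact (h'.markE b).trans (h.markE a)
  vcol := by rintro _ _ ⟨_, a, b⟩; exact optionRel_trans (h.vcol a) (h'.vcol b)
  ecol := by rintro _ _ ⟨_, a, b⟩; exact optionRel_trans (h.ecol a) (h'.ecol b)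

/-- An isomorphism of `r`-balls is a local isomorphism: as geodesics from the root stay in the ball,
it preserves the distances to the root, both in the total graphs and in the cores. -/
theorem Close.exists_localIso (h : Close r D D') :
    ∃ P Q, LocalIso r (1 / (r : ℝ)) D D' P Q := by
  obtain ⟨f, g, hroot, harc, hcV, hcE, hmV, hmE, hvc, hec⟩ := h
  set P : D.V → D'.V → Prop := fun x x' => ∃ h, (f ⟨x, h⟩ : D'.V) = x' with hP
  set Q : D.E → D'.E → Prop := fun x x' => ∃ h, (g ⟨x, h⟩ : D'.E) = x' with hQ
  have vtot : ∀ x ∈ D.graph.ballV Set.univ D.root r, ∃ x', P x x' := fun x hx => ⟨_, hx, rfl⟩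
  have vsurj : ∀ x' ∈ D'.graph.ballV Set.univ D'.root r, ∃ x, P x x' := by
    intro x' hx'
    obtain ⟨⟨x, hx⟩, h⟩ := f.surjective ⟨x', hx'⟩
    exact ⟨x, hx, by rw [h]⟩
  have etot : ∀ x ∈ D.graph.ballE Set.univ D.root r, ∃ x', Q x x' := fun x hx => ⟨_, hx, rfl⟩
  have esurj : ∀ x' ∈ D'.graph.ballE Set.univ D'.root r, ∃ x, Q x x' := by
    intro x' hx'
    obtain ⟨⟨x, hx⟩, h⟩ := g.surjective ⟨x', hx'⟩
    exact ⟨x, hx, by rw [h]⟩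
  have arc : ∀ ⦃e e' x x' y y'⦄, Q e e' → P x x' → P y y' →
      (D'.graph.Arc e' x' y' ↔ D.graph.Arc e x y) := by
    rintro e _ x _ y _ ⟨he, rfl⟩ ⟨hx, rfl⟩ ⟨hy, rfl⟩
    exact harc ⟨e, he⟩ ⟨x, hx⟩ ⟨y, hy⟩
  have arc1 : ∀ ⦃e e' x x' y y'⦄, Q e e' → P x x' → P y y' → D.graph.Arc e x y →
      D'.graph.Arc e' x' y' := fun _ _ _ _ _ _ a b c => (arc a b c).2
  have arc2 : ∀ ⦃e e' x x' y y'⦄, flip Q e e' → flip P x x' → flip P y y' → D'.graph.Arc e x y →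
      D.graph.Arc e' x' y' := fun _ _ _ _ _ _ a b c => (arc a b c).1
  have vfun : ∀ ⦃x x' x''⦄, P x x' → P x x'' → x' = x'' := by
    rintro x _ _ ⟨_, rfl⟩ ⟨_, rfl⟩; rfl
  have vinj : ∀ ⦃x y x'⦄, P x x' → P y x' → x = y := by
    rintro x y _ ⟨hx, rfl⟩ ⟨hy, h⟩
    exact congrArg Subtype.val (f.injective (Subtype.ext h.symm))
  have root : P D.root D'.root := ⟨Diagram.root_mem_ballV, hroot _ rfl⟩
  have hfun : ∀ x', P D.root x' → x' = D'.root := fun x' h => vfun h root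
  have hinj : ∀ x, flip P D'.root x → x = D.root := fun x h => vinj h root
  have codV : ∀ {x x'}, P x x' → x' ∈ D'.graph.ballV Set.univ D'.root r := by
    rintro x _ ⟨hx, rfl⟩; exact (f ⟨x, hx⟩).2
  have codE : ∀ {x x'}, Q x x' → x' ∈ D'.graph.ballE Set.univ D'.root r := by
    rintro x _ ⟨hx, rfl⟩; exact (g ⟨x, hx⟩).2
  have ballV : ∀ s ≤ r, ∀ ⦃x x'⦄, P x x' →
      (x' ∈ D'.graph.ballV Set.univ D'.root s ↔ x ∈ D.graph.ballV Set.univ D.root s) := by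
    intro s hs x x' hx
    constructor
    · exact Diagram.mem_ballV_of_rel (P := flip P) (Q := flip Q) hinj vsurj
        (fun e he => (esurj e he).imp fun _ h => ⟨trivial, h⟩) arc2 s hs x' x hx
    · exact Diagram.mem_ballV_of_rel (P := P) (Q := Q) hfun vtot
        (fun e he => (etot e he).imp fun _ h => ⟨trivial, h⟩) arc1 s hs x x' hx
  have subV : D.graph.ballV D.core.edges D.root r ⊆ D.graph.ballV Set.univ D.root r :=
    Diagram.ballV_mono_edges (Set.subset_univ _)
  have subV' : D'.graph.ballV D'.core.edges D'.root r ⊆ D'.graph.ballV Set.univ D'.root r :=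
    Diagram.ballV_mono_edges (Set.subset_univ _)
  have ctot : ∀ x ∈ D.graph.ballV D.core.edges D.root r, ∃ x', P x x' := fun x h => vtot x (subV h)
  have csurj : ∀ x ∈ D'.graph.ballV D'.core.edges D'.root r, ∃ x', flip P x x' :=
    fun x h => vsurj x (subV' h)
  have core1 : ∀ {e e'}, Q e e' → e ∈ D.graph.ballE D.core.edges D.root r → e' ∈ D'.core.edges := by
    rintro e _ ⟨he, rfl⟩ h
    exact ((hcE ⟨e, he⟩).2 h).1
  have core2 : ∀ {e e'}, Q e e' → e' ∈ D'.graph.ballE D'.core.edges D'.root r →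
      e ∈ D.core.edges := by
    rintro e _ ⟨he, rfl⟩ h
    exact ((hcE ⟨e, he⟩).1 h).1
  have coreV : ∀ s ≤ r, ∀ ⦃x x'⦄, P x x' →
    (x' ∈ D'.graph.ballV D'.core.edges D'.root s ↔ x ∈ D.graph.ballV D.core.edges D.root s) := by
    intro s hs x x' hx
    constructor
    · refine Diagram.mem_ballV_of_rel (P := flip P) (Q := flip Q) hinj csurj
        (fun e he => ?_) arc2 s hs x' x hx
      obtain ⟨e', h⟩ := esurj e (Diagram.ballE_mono_edges (Set.subset_univ _) he)
      exact ⟨e', core2 h he, h⟩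
    · refine Diagram.mem_ballV_of_rel (P := P) (Q := Q) hfun ctot
        (fun e he => ?_) arc1 s hs x x' hx
      obtain ⟨e', h⟩ := etot e (Diagram.ballE_mono_edges (Set.subset_univ _) he)
      exact ⟨e', core1 h he, h⟩
  refine ⟨P, Q, root, vtot, vsurj, vfun, vinj, etot, esurj, ?_, ?_, arc, ballV, ?_, coreV, ?_,
    ?_, ?_, ?_, ?_⟩
  · rintro x _ _ ⟨_, rfl⟩ ⟨_, rfl⟩; rfl
  · rintro x y _ ⟨hx, rfl⟩ ⟨hy, h⟩
    exact congrArg Subtype.val (g.injective (Subtype.ext h.symm))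
  · intro s hs e e' hQ
    constructor
    · exact Diagram.mem_ballE_of_rel (P := flip P) (Q := flip Q) hQ trivial
        (fun x hx => vsurj x (Diagram.ballV_mono hs hx)) (fun x x' h => (ballV s hs h).1) arc2
    · exact Diagram.mem_ballE_of_rel (P := P) (Q := Q) hQ trivial
        (fun x hx => vtot x (Diagram.ballV_mono hs hx)) (fun x x' h => (ballV s hs h).2) arc1
  · intro s hs e e' hQ
    constructor
    · intro h
      exact Diagram.mem_ballE_of_rel (P := flip P) (Q := flip Q) hQ
        (core2 hQ (Diagram.ballE_mono hs h))
        (fun x hx => csurj x (Diagram.ballV_mono hs hx)) (fun x x' h => (coreV s hs h).1) arc2 h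
    · intro h
      exact Diagram.mem_ballE_of_rel (P := P) (Q := Q) hQ
        (core1 hQ (Diagram.ballE_mono hs h))
        (fun x hx => ctot x (Diagram.ballV_mono hs hx)) (fun x x' h => (coreV s hs h).2) arc1 h
  · rintro x _ ⟨hx, rfl⟩; exact hmV ⟨x, hx⟩
  · rintro x _ ⟨hx, rfl⟩; exact hmE ⟨x, hx⟩
  · rintro x _ ⟨hx, rfl⟩; exact hvc ⟨x, hx⟩
  · rintro x _ ⟨hx, rfl⟩; exact hec ⟨x, hx⟩

end

end RDGraph

/-! ### The local topology is Hausdorff -/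

theorem exists_equiv_of_rel {α β : Type*} {R : α → β → Prop} (htot : ∀ a, ∃ b, R a b)
    (hsurj : ∀ b, ∃ a, R a b) (hfun : ∀ ⦃a b b'⦄, R a b → R a b' → b = b')
    (hinj : ∀ ⦃a a' b⦄, R a b → R a' b → a = a') : ∃ f : α ≃ β, ∀ a, R a (f a) := by
  choose f hf using htot
  refine ⟨Equiv.ofBijective f ⟨fun a a' h => hinj (hf a) (h ▸ hf a'), fun b => ?_⟩, hf⟩
  obtain ⟨a, ha⟩ := hsurj b
  exact ⟨a, hfun (hf a) ha⟩

namespace RDGraph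

variable {K : Type v}

section

variable [PseudoMetricSpace K] {D D' D'' : RDGraph.{u, v} K} {r s : ℕ} {ε ε' : ℝ}
  {P : D.V → D'.V → Prop} {Q : D.E → D'.E → Prop}

theorem Equivalent.exists_localIso (h : D.Equivalent D') (r : ℕ) :
    ∃ P Q, LocalIso r 0 D D' P Q := by
  obtain ⟨f, h1, h2, h3, h4, h5, h6⟩ := h
  have hrel : ∀ a : Option K, Option.Rel (fun a b => dist a b ≤ 0) a a := by
    rintro (_ | a)
    exacts [.none, .some (dist_self a).le]
  refine ⟨fun x x' => f.onV x = x', fun x x' => f.onE x = x', h1, fun x _ => ⟨_, rfl⟩,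
    fun x _ => f.onV.surjective x, ?_, ?_, fun x _ => ⟨_, rfl⟩, fun x _ => f.onE.surjective x,
    ?_, ?_, ?_, ?_, ?_, ?_, ?_, ?_, ?_, ?_, ?_⟩
  · rintro x _ _ rfl rfl; rfl
  · rintro x y _ rfl h; exact f.onV.injective h.symm
  · rintro x _ _ rfl rfl; rfl
  · rintro x y _ rfl h; exact f.onE.injective h.symm
  · rintro e _ x _ y _ rfl rfl rfl; exact f.arc e x y
  · rintro s - x _ rfl; rw [← h1]; exact f.mem_ballV_iff fun _ => Iff.rfl
  · rintro s - x _ rfl; rw [← h1]; exact f.mem_ballE_iff fun _ => Iff.rfl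
  · rintro s - x _ rfl; rw [← h1]; exact f.mem_ballV_iff h4
  · rintro s - x _ rfl; rw [← h1]; exact f.mem_ballE_iff h4
  · rintro x _ rfl; exact h5 x
  · rintro x _ rfl; exact h6 x
  · rintro x _ rfl; rw [h2]; exact hrel _
  · rintro x _ rfl; rw [f.ecol]; exact hrel _

end

theorem eq_of_eventually_optionRel [MetricSpace K] {l : Filter ℕ} [l.NeBot] {ε : ℕ → ℝ}
    (hε : Filter.Tendsto ε l (nhds 0)) {a b : Option K}
    (h : ∀ᶠ n in l, Option.Rel (fun a b => dist a b ≤ ε n) a b) : a = b := by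
  rcases a with _ | a <;> rcases b with _ | b
  · rfl
  · obtain ⟨n, hn⟩ := h.exists; cases hn
  · obtain ⟨n, hn⟩ := h.exists; cases hn
  · have h' : ∀ᶠ n in l, dist a b ≤ ε n := h.mono fun n hn => by cases hn; assumption
    rw [dist_le_zero.1 (ge_of_tendsto hε h')]

theorem mem_core_verts_iff (D : RDGraph.{u, v} K) {x : D.V} :
    x ∈ D.core.verts ↔ ∃ r, x ∈ D.graph.ballV D.core.edges D.root r := by
  rw [← Diagram.reachable_iff_mem_ballV]
  exact ⟨D.core_conn x, Diagram.Sub.mem_verts_of_reachable D.root_mem⟩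

theorem mem_core_edges_iff (D : RDGraph.{u, v} K) {e : D.E} :
    e ∈ D.core.edges ↔ ∃ r, e ∈ D.graph.ballE D.core.edges D.root r := by
  refine ⟨fun he => Diagram.exists_mem_ballE he fun x y h => ?_, fun ⟨r, h⟩ => h.1⟩
  have := D.core.ends_mem e he x y h
  exact ⟨D.core_conn x this.1, D.core_conn y this.2⟩

theorem exists_mem_ballV (D : RDGraph.{u, v} K) (x : D.V) :
    ∃ r, x ∈ D.graph.ballV Set.univ D.root r :=
  Diagram.reachable_iff_mem_ballV.1 (D.conn.preconnected _ _)

theorem exists_mem_ballE (D : RDGraph.{u, v} K) (e : D.E) :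
    ∃ r, e ∈ D.graph.ballE Set.univ D.root r :=
  Diagram.exists_mem_ballE (Set.mem_univ e) fun _ _ _ =>
    ⟨D.conn.preconnected _ _, D.conn.preconnected _ _⟩

/-- By local finiteness, local isomorphisms of all radii have a limit along an ultrafilter, which is
an isomorphism of the whole decorated graphs. -/
theorem equivalent_of_forall_localIso [MetricSpace K] {D D' : RDGraph.{u, v} K} {ε : ℕ → ℝ}
    (hε : Filter.Tendsto ε Filter.atTop (nhds 0))
    (h : ∀ n, ∃ P Q, LocalIso n (ε n) D D' P Q) : D.Equivalent D' := by
  choose P Q h using h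
  let U : Ultrafilter ℕ := Filter.hyperfilter ℕ
  have hU : (U : Filter ℕ) ≤ Filter.atTop := Nat.hyperfilter_le_atTop
  have large : ∀ r, ∀ᶠ n in (U : Filter ℕ), r ≤ n := fun r => hU (Filter.eventually_ge_atTop r)
  obtain ⟨f, hf⟩ := exists_equiv_of_rel (R := fun x x' => ∀ᶠ n in (U : Filter ℕ), P n x x')
    (fun x => by
      obtain ⟨r, hr⟩ := D.exists_mem_ballV x
      have hfin := D'.locFin.finite_ballV Set.univ D'.root r
      have := (U.eventually_exists_mem_iff hfin (P := fun x' n => P n x x')).1 (by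
        filter_upwards [large r] with n hn
        obtain ⟨x', hx'⟩ := (h n).vtot x (Diagram.ballV_mono hn hr)
        exact ⟨x', ((h n).ballV r hn hx').2 hr, hx'⟩)
      exact this.imp fun _ h => h.2)
    (fun x' => by
      obtain ⟨r, hr⟩ := D'.exists_mem_ballV x'
      have hfin := D.locFin.finite_ballV Set.univ D.root r
      have := (U.eventually_exists_mem_iff hfin (P := fun x n => P n x x')).1 (by
        filter_upwards [large r] with n hn
        obtain ⟨x, hx⟩ := (h n).vsurj x' (Diagram.ballV_mono hn hr)
        exact ⟨x, ((h n).ballV r hn hx).1 hr, hx⟩)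
      exact this.imp fun _ h => h.2)
    (fun x x' x'' h1 h2 => by
      obtain ⟨n, h1, h2⟩ := (h1.and h2).exists
      exact (h n).vfun h1 h2)
    (fun x x' x'' h1 h2 => by
      obtain ⟨n, h1, h2⟩ := (h1.and h2).exists
      exact (h n).vinj h1 h2)
  obtain ⟨g, hg⟩ := exists_equiv_of_rel (R := fun x x' => ∀ᶠ n in (U : Filter ℕ), Q n x x')
    (fun x => by
      obtain ⟨r, hr⟩ := D.exists_mem_ballE x
      have hfin := D'.locFin.finite_ballE Set.univ D'.root r
      have := (U.eventually_exists_mem_iff hfin (P := fun x' n => Q n x x')).1 (by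
        filter_upwards [large r] with n hn
        obtain ⟨x', hx'⟩ := (h n).etot x (Diagram.ballE_mono hn hr)
        exact ⟨x', ((h n).ballE r hn hx').2 hr, hx'⟩)
      exact this.imp fun _ h => h.2)
    (fun x' => by
      obtain ⟨r, hr⟩ := D'.exists_mem_ballE x'
      have hfin := D.locFin.finite_ballE Set.univ D.root r
      have := (U.eventually_exists_mem_iff hfin (P := fun x n => Q n x x')).1 (by
        filter_upwards [large r] with n hn
        obtain ⟨x, hx⟩ := (h n).esurj x' (Diagram.ballE_mono hn hr)
        exact ⟨x, ((h n).ballE r hn hx).1 hr, hx⟩)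
      exact this.imp fun _ h => h.2)
    (fun x x' x'' h1 h2 => by
      obtain ⟨n, h1, h2⟩ := (h1.and h2).exists
      exact (h n).efun h1 h2)
    (fun x x' x'' h1 h2 => by
      obtain ⟨n, h1, h2⟩ := (h1.and h2).exists
      exact (h n).einj h1 h2)
  refine ⟨⟨f, g, fun e x y => ?_, fun e => ?_⟩, ?_, fun x => ?_, fun x => ?_, fun e => ?_,
    fun x => ?_, fun e => ?_⟩
  · obtain ⟨n, ⟨he, hx⟩, hy⟩ := (((hg e).and (hf x)).and (hf y)).exists
    exact (h n).arc he hx hy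
  · exact (eq_of_eventually_optionRel (hε.mono_left hU)
      ((hg e).mono fun n hn => (h n).ecol hn)).symm
  · obtain ⟨n, hn⟩ := (hf D.root).exists
    exact (h n).vfun hn (h n).root
  · exact (eq_of_eventually_optionRel (hε.mono_left hU)
      ((hf x).mono fun n hn => (h n).vcol hn)).symm
  · rw [mem_core_verts_iff, mem_core_verts_iff]
    refine exists_congr fun r => ?_
    obtain ⟨n, hn, hr⟩ := ((hf x).and (large r)).exists
    exact (h n).coreV r hr hn
  · rw [mem_core_edges_iff, mem_core_edges_iff]
    refine exists_congr fun r => ?_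
    obtain ⟨n, hn, hr⟩ := ((hg e).and (large r)).exists
    exact (h n).coreE r hr hn
  · obtain ⟨n, hn⟩ := (hf x).exists
    exact (h n).markV hn
  · obtain ⟨n, hn⟩ := (hg e).exists
    exact (h n).markE hn

end RDGraph

namespace GDeco

variable {K : Type v}

instance [Dist K] : BorelSpace (GDeco.{u, v} K) := ⟨rfl⟩

theorem mk_eq_mk {D D' : RDGraph.{u, v} K} : mk D = mk D' ↔ D.Equivalent D' := Quotient.eq

/-- The decorated graphs whose `r`-ball agrees with that of `D` up to a change of the colours
by less than `1 / (r + 1)`. -/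
def ball [PseudoMetricSpace K] (D : RDGraph.{u, v} K) (r : ℕ) : Set (GDeco.{u, v} K) :=
  {q | ∃ X, mk X = q ∧ ∃ ε < 1 / ((r : ℝ) + 1), ∃ P Q, D.LocalIso r ε X P Q}

theorem mem_ball_self [PseudoMetricSpace K] (D : RDGraph.{u, v} K) (r : ℕ) : mk D ∈ ball D r :=
  ⟨D, rfl, 0, by positivity, (RDGraph.Equivalent.refl D).exists_localIso r⟩

/-- Since the change `ε` of the colours is strictly less than `1 / (r + 1)`, there is room for a
further small change. -/
theorem isOpen_ball [PseudoMetricSpace K] (D : RDGraph.{u, v} K) (r : ℕ) : IsOpen (ball D r) := by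
  rintro X ⟨Y, hY, ε, hε, P, Q, h⟩
  obtain ⟨P', Q', h'⟩ := (mk_eq_mk.1 hY).exists_localIso r
  have hX := h.trans h'
  rw [add_zero] at hX
  obtain ⟨N, hN⟩ := exists_nat_one_div_lt (sub_pos.2 hε)
  refine ⟨max r (N + 1), fun R hR X' hX' => ⟨X', rfl, ε + 1 / (R : ℝ), ?_, ?_⟩⟩
  · have : 1 / (R : ℝ) ≤ 1 / ((N : ℝ) + 1) :=
      one_div_le_one_div_of_le (by positivity) (by exact_mod_cast le_of_max_le_right hR)
    linarith
  · obtain ⟨P'', Q'', h''⟩ := hX'.exists_localIso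
    exact ⟨_, _, hX.trans (h''.mono (le_of_max_le_left hR))⟩

instance [MetricSpace K] : T2Space (GDeco.{u, v} K) where
  t2 := by
    intro q q' hne
    induction q using Quotient.inductionOn with | h D => ?_
    induction q' using Quotient.inductionOn with | h D' => ?_
    by_contra hcon
    refine hne (mk_eq_mk.2 (RDGraph.equivalent_of_forall_localIso
      (ε := fun n => 1 / ((n : ℝ) + 1) + 1 / ((n : ℝ) + 1)) ?_ fun n => ?_))
    · simpa using (tendsto_one_div_add_atTop_nhds_zero_nat (𝕜 := ℝ)).add
        (tendsto_one_div_add_atTop_nhds_zero_nat (𝕜 := ℝ))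
    · by_contra h
      refine hcon ⟨ball D n, ball D' n, isOpen_ball D n, isOpen_ball D' n, mem_ball_self D n,
        mem_ball_self D' n, Set.disjoint_left.2 ?_⟩
      rintro _ ⟨X, rfl, ε, hε, P, Q, hX⟩ ⟨Y, hY, ε', hε', P', Q', hY'⟩
      obtain ⟨P'', Q'', hYX⟩ := (mk_eq_mk.1 hY).exists_localIso n
      have := hX.trans (hY'.trans hYX).symm
      exact h ⟨_, _, this.weaken (by linarith)⟩

end GDeco

/-! ### Decorated components and automorphisms -/

namespace RDGraph

variable {K : Type v}

theorem Equivalent.reroot {D D' : RDGraph.{u, v} K} (h : D.Equivalent D') {x : D.V}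
    (hx : x ∈ D.core.verts) :
    ∃ x', ∃ hx' : x' ∈ D'.core.verts, (D.reroot x hx).Equivalent (D'.reroot x' hx') := by
  obtain ⟨f, h1, h2, h3, h4, h5, h6⟩ := h
  exact ⟨f.onV x, (h3 x).2 hx, f, rfl, h2, h3, h4, h5, h6⟩

end RDGraph

namespace Diagram

variable {V E : Type u} {K : Type v} {G : Diagram V E K} {o x y : V} {r : ℕ}

theorem Sub.mem_comp_iff {ω : G.Sub} : x ∈ ω.comp o ↔ ∃ r, x ∈ G.ballV ω.edges o r :=
  reachable_iff_mem_ballV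

theorem Sub.comp_eq_of_mem {ω : G.Sub} (h : x ∈ ω.comp o) : ω.comp x = ω.comp o :=
  Set.ext fun _ => ⟨fun h' => SimpleGraph.Reachable.trans h h',
    fun h' => (SimpleGraph.Reachable.symm h).trans h'⟩

theorem Sub.mem_comp_comm {ω : G.Sub} : x ∈ ω.comp o ↔ o ∈ ω.comp x :=
  ⟨SimpleGraph.Reachable.symm, SimpleGraph.Reachable.symm⟩

theorem Iso.mem_mapSub_verts (γ : G.Iso G) (ω : G.Sub) :
    γ.onV x ∈ (γ.mapSub ω).verts ↔ x ∈ ω.verts := γ.onV.injective.mem_set_image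

theorem Iso.mem_mapSub_edges (γ : G.Iso G) (ω : G.Sub) {e : E} :
    γ.onE e ∈ (γ.mapSub ω).edges ↔ e ∈ ω.edges := γ.onE.injective.mem_set_image

theorem Iso.mem_mapSub_comp (γ : G.Iso G) (ω : G.Sub) :
    γ.onV x ∈ (γ.mapSub ω).comp (γ.onV o) ↔ x ∈ ω.comp o := by
  rw [Sub.mem_comp_iff, Sub.mem_comp_iff]
  exact exists_congr fun r => γ.mem_ballV_iff fun e => γ.mem_mapSub_edges ω

theorem equivalent_mapSub (hG : G.IsCayley) (γ : G.Iso G) (ω : G.Sub) {χ χ' : V → Option K}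
    (h : ∀ x, χ' (γ.onV x) = χ x) (o : V) :
    (G.decoratedComponent hG ω χ o).Equivalent
      (G.decoratedComponent hG (γ.mapSub ω) χ' (γ.onV o)) := by
  refine ⟨γ, rfl, h, fun x => γ.mem_mapSub_comp ω, fun e => ?_, fun x => γ.mem_mapSub_verts ω,
    fun e => γ.mem_mapSub_edges ω⟩
  refine and_congr (γ.mem_mapSub_edges ω) ⟨?_, ?_⟩
  · rintro ⟨x, y, h, hx⟩
    obtain ⟨x, rfl⟩ := γ.onV.surjective x
    obtain ⟨y, rfl⟩ := γ.onV.surjective y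
    exact ⟨x, y, (γ.arc e x y).1 h, (γ.mem_mapSub_comp ω).1 hx⟩
  · rintro ⟨x, y, h, hx⟩
    exact ⟨_, _, (γ.arc e x y).2 h, (γ.mem_mapSub_comp ω).2 hx⟩

theorem equivalent_reroot (hG : G.IsCayley) (ω : G.Sub) (χ : V → Option K) (hx : x ∈ ω.comp o) :
    ((G.decoratedComponent hG ω χ o).reroot x hx).Equivalent
      (G.decoratedComponent hG ω χ x) := by
  refine ⟨Iso.refl G, rfl, fun _ => rfl, fun y => ?_, fun e => ?_, fun _ => Iff.rfl,
    fun _ => Iff.rfl⟩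
  · change y ∈ ω.comp x ↔ y ∈ ω.comp o
    rw [Sub.comp_eq_of_mem hx]
  · change (e ∈ ω.edges ∧ ∃ a b, G.Arc e a b ∧ a ∈ ω.comp x) ↔
      (e ∈ ω.edges ∧ ∃ a b, G.Arc e a b ∧ a ∈ ω.comp o)
    rw [Sub.comp_eq_of_mem hx]

/-- For an invariant property, the choice of the root in a component does not matter. -/
theorem mem_iff_of_mem_comp [Dist K] (hG : G.IsCayley) {A : Set (GDeco.{u, v} K)}
    (hA : GDeco.IsInvariantProperty A) (ω : G.Sub) (χ : V → Option K) (hx : x ∈ ω.comp o) :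
    GDeco.mk (G.decoratedComponent hG ω χ x) ∈ A ↔
      GDeco.mk (G.decoratedComponent hG ω χ o) ∈ A := by
  have key : ∀ {o x : V}, x ∈ ω.comp o → GDeco.mk (G.decoratedComponent hG ω χ o) ∈ A →
      GDeco.mk (G.decoratedComponent hG ω χ x) ∈ A := fun hx h => by
    rw [← GDeco.mk_eq_mk.2 (equivalent_reroot hG ω χ hx)]
    exact hA.2 _ _ _ h
  exact ⟨key (Sub.mem_comp_comm.1 hx), key hx⟩

/-! ### The decorated component depends continuously on the configuration -/

theorem mem_ballV_core {ω : G.Sub} :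
    x ∈ G.ballV {e ∈ ω.edges | ∃ x y, G.Arc e x y ∧ x ∈ ω.comp o} o r ↔
      x ∈ G.ballV ω.edges o r := by
  refine ⟨fun h => ballV_mono_edges (Set.sep_subset _ _) h, fun h => ?_⟩
  refine mem_ballV_of_rel (G := G) (G' := G) (P := Eq) (Q := Eq) (F := ω.edges)
    (F' := {e ∈ ω.edges | ∃ x y, G.Arc e x y ∧ x ∈ ω.comp o}) (fun _ h => h.symm)
    (fun x _ => ⟨x, rfl⟩) (fun e he => ⟨e, ⟨he.1, ?_⟩, rfl⟩) ?_ r le_rfl x x rfl h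
  · obtain ⟨a, b, hab⟩ := G.exists_arc e
    exact ⟨a, b, hab, Sub.mem_comp_iff.2 ⟨r, (he.2 a b hab).1⟩⟩
  · rintro e _ x _ y _ rfl rfl rfl h
    exact h

theorem mem_ballE_core {ω : G.Sub} {e : E} :
    e ∈ G.ballE {e ∈ ω.edges | ∃ x y, G.Arc e x y ∧ x ∈ ω.comp o} o r ↔
      e ∈ G.ballE ω.edges o r := by
  refine ⟨fun h => ballE_mono_edges (Set.sep_subset _ _) h, fun h => ?_⟩
  refine ⟨⟨h.1, ?_⟩, fun a b hab => ?_⟩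
  · obtain ⟨a, b, hab⟩ := G.exists_arc e
    exact ⟨a, b, hab, Sub.mem_comp_iff.2 ⟨r, (h.2 a b hab).1⟩⟩
  · rw [mem_ballV_core, mem_ballV_core]
    exact h.2 a b hab

theorem ballV_subset_of_agree {F F' : Set E}
    (h : ∀ e ∈ G.ballE Set.univ o r, e ∈ F → e ∈ F') : G.ballV F o r ⊆ G.ballV F' o r := by
  intro x hx
  refine mem_ballV_of_rel (P := Eq) (Q := Eq) (fun _ h => h.symm) (fun x _ => ⟨x, rfl⟩)
    (fun e he => ⟨e, h e (ballE_mono_edges (Set.subset_univ _) he) he.1, rfl⟩) ?_ r le_rfl x x rfl hx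
  rintro e _ x _ y _ rfl rfl rfl h
  exact h

/-- Configurations agreeing in the `r`-ball of `G` have decorated components that are locally
close. -/
theorem close_of_agree [PseudoMetricSpace K] (hG : G.IsCayley) {ω ω' : G.Sub} {χ χ' : V → Option K}
    (hV : ∀ x ∈ G.ballV Set.univ o r, x ∈ ω'.verts ↔ x ∈ ω.verts)
    (hE : ∀ e ∈ G.ballE Set.univ o r, e ∈ ω'.edges ↔ e ∈ ω.edges)
    (hχ : ∀ x ∈ G.ballV Set.univ o r, Option.Rel (fun a b => dist a b ≤ 1 / (r : ℝ)) (χ x) (χ' x)) :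
    RDGraph.Close r (G.decoratedComponent hG ω χ o) (G.decoratedComponent hG ω' χ' o) := by
  have hball : G.ballV ω'.edges o r = G.ballV ω.edges o r :=
    (ballV_subset_of_agree fun e he => (hE e he).1).antisymm
      (ballV_subset_of_agree fun e he => (hE e he).2)
  refine ⟨Equiv.refl _, Equiv.refl _, fun _ h => h, fun _ _ _ => Iff.rfl, fun x => ?_, fun e => ?_,
    fun x => hV x.1 x.2, fun e => hE e.1 e.2, fun x => hχ x.1 x.2, fun e => ?_⟩
  · refine mem_ballV_core.trans (Iff.trans ?_ mem_ballV_core.symm)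
    change x.1 ∈ G.ballV ω'.edges o r ↔ x.1 ∈ G.ballV ω.edges o r
    rw [hball]
  · refine mem_ballE_core.trans (Iff.trans ?_ mem_ballE_core.symm)
    change e.1 ∈ G.ballE ω'.edges o r ↔ e.1 ∈ G.ballE ω.edges o r
    exact and_congr (hE e.1 e.2) (by rw [hball])
  · change Option.Rel _ (G.ecol e.1) (G.ecol e.1)
    cases G.ecol e.1 with
    | none => exact .none
    | some a => exact .some (by rw [dist_self]; positivity)

/-- The subgraph of `G` coded by a pair of indicator functions, where edges with an end outside of
the set of vertices are discarded. This maps a Cantor space onto the space of subgraphs. -/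
def subOf (G : Diagram V E K) (z : (V → Bool) × (E → Bool)) : G.Sub where
  verts := {x | z.1 x = true}
  edges := {e | z.2 e = true ∧ ∀ x y, G.Arc e x y → z.1 x = true ∧ z.1 y = true}
  ends_mem _ he x y h := he.2 x y h

open Classical in
/-- The indicator functions of a subgraph. -/
noncomputable def Sub.code (ω : G.Sub) : (V → Bool) × (E → Bool) :=
  (fun x => decide (x ∈ ω.verts), fun e => decide (e ∈ ω.edges))

theorem subOf_code (ω : G.Sub) : G.subOf ω.code = ω := by
  apply Sub.ext
  · ext x; simp [subOf, Sub.code]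
  · ext e
    simp only [subOf, Sub.code, decide_eq_true_eq]
    exact ⟨fun h => h.1, fun h => ⟨h, ω.ends_mem e h⟩⟩

theorem measurable_sub_iff {α : Type*} [MeasurableSpace α] {f : α → G.Sub} :
    Measurable f ↔ (∀ x, MeasurableSet {a | x ∈ (f a).verts}) ∧
      ∀ e, MeasurableSet {a | e ∈ (f a).edges} := by
  have h : Measurable f ↔ Measurable fun a => ((f a).verts, (f a).edges) := measurable_comap_iff
  simp only [measurableSet_setOfPred, ← measurable_set_iff, h]
  exact ⟨fun h => ⟨h.fst, h.snd⟩, fun h => h.1.prodMk h.2⟩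

theorem measurableSet_mem_verts (x : V) : MeasurableSet {ω : G.Sub | x ∈ ω.verts} :=
  (measurable_sub_iff.1 measurable_id).1 x

theorem measurableSet_mem_edges (e : E) : MeasurableSet {ω : G.Sub | e ∈ ω.edges} :=
  (measurable_sub_iff.1 measurable_id).2 e

theorem measurable_mapSub (γ : G.Iso G) : Measurable γ.mapSub := by
  refine measurable_sub_iff.2 ⟨fun x => ?_, fun e => ?_⟩
  · obtain ⟨x, rfl⟩ := γ.onV.surjective x
    simp only [γ.mem_mapSub_verts]
    exact measurableSet_mem_verts x
  · obtain ⟨e, rfl⟩ := γ.onE.surjective e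
    simp only [γ.mem_mapSub_edges]
    exact measurableSet_mem_edges e

theorem measurable_code : Measurable (Sub.code : G.Sub → _) := by
  classical
  refine Measurable.prodMk (measurable_pi_iff.2 fun x => ?_) (measurable_pi_iff.2 fun e => ?_)
  · refine measurable_to_bool ?_
    simpa [Set.preimage] using measurableSet_mem_verts x
  · refine measurable_to_bool ?_
    simpa [Set.preimage] using measurableSet_mem_edges e

theorem measurable_subOf [Countable V] : Measurable G.subOf := by
  have h1 : ∀ x, MeasurableSet {z : (V → Bool) × (E → Bool) | z.1 x = true} := fun x =>
    measurableSet_eq_fun (by fun_prop) measurable_const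
  have h2 : ∀ e, MeasurableSet {z : (V → Bool) × (E → Bool) | z.2 e = true} := fun e =>
    measurableSet_eq_fun (by fun_prop) measurable_const
  refine measurable_sub_iff.2 ⟨h1, fun e => (h2 e).inter ?_⟩
  exact measurableSet_setOfPred.2 (Measurable.forall fun x => Measurable.forall fun y =>
    measurable_const.imp (measurableSet_setOfPred.1 ((h1 x).inter (h1 y))))

/-- The decorated component depends continuously on the code of the subgraph and on the colouring,
because its `r`-ball is determined by the configuration in the finite `r`-ball of `G`. -/
theorem continuous_decoratedComponent [PseudoMetricSpace K] (hG : G.IsCayley) (o : V) {Y : Type*}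
    [TopologicalSpace Y] {χ : Y → V → Option K}
    (hχ : ∀ y x, ∀ ε > 0, ∀ᶠ y' in nhds y, Option.Rel (fun a b => dist a b ≤ ε) (χ y x) (χ y' x)) :
    Continuous fun p : ((V → Bool) × (E → Bool)) × Y =>
      GDeco.mk (G.decoratedComponent hG (G.subOf p.1) (χ p.2) o) := by
  refine continuous_def.2 fun U hU => isOpen_iff_mem_nhds.2 fun p hp => ?_
  obtain ⟨R, hR⟩ := hU _ hp
  have hfV := hG.locFin.finite_ballV Set.univ o (max R 1)
  have hfE := hG.locFin.finite_ballE Set.univ o (max R 1)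
  have e1 : ∀ᶠ p' : ((V → Bool) × (E → Bool)) × Y in nhds p,
      ∀ x ∈ G.ballV Set.univ o (max R 1), p'.1.1 x = p.1.1 x :=
    (Filter.eventually_all_finite hfV).2 fun x _ =>
      (show Continuous fun p' : ((V → Bool) × (E → Bool)) × Y => p'.1.1 x by
        fun_prop).continuousAt.eventually (p := fun b => b = p.1.1 x) (mem_nhds_discrete.2 rfl)
  have e2 : ∀ᶠ p' : ((V → Bool) × (E → Bool)) × Y in nhds p,
      ∀ e ∈ G.ballE Set.univ o (max R 1), p'.1.2 e = p.1.2 e :=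
    (Filter.eventually_all_finite hfE).2 fun e _ =>
      (show Continuous fun p' : ((V → Bool) × (E → Bool)) × Y => p'.1.2 e by
        fun_prop).continuousAt.eventually (p := fun b => b = p.1.2 e) (mem_nhds_discrete.2 rfl)
  have e3 : ∀ᶠ p' : ((V → Bool) × (E → Bool)) × Y in nhds p,
      ∀ x ∈ G.ballV Set.univ o (max R 1),
        Option.Rel (fun a b => dist a b ≤ 1 / ((max R 1 : ℕ) : ℝ)) (χ p.2 x) (χ p'.2 x) :=
    (Filter.eventually_all_finite hfV).2 fun x _ =>
      continuous_snd.continuousAt.eventually (hχ p.2 x _ (by positivity))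
  filter_upwards [e1, e2, e3] with p' h1 h2 h3
  refine hR (max R 1) (le_max_left _ _) _ (close_of_agree hG (fun x hx => ?_) (fun e he => ?_) h3)
  · change p'.1.1 x = true ↔ p.1.1 x = true
    rw [h1 x hx]
  · refine and_congr (by rw [h2 e he]) (forall₂_congr fun x y => imp_congr_right fun hxy => ?_)
    rw [h1 x (he.2 x y hxy).1, h1 y (he.2 x y hxy).2]

theorem measurable_decoratedComponent [PseudoMetricSpace K] [TopologicalSpace.SeparableSpace K]
    [MeasurableSpace K] [BorelSpace K] (hG : G.IsCayley) (o : V) :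
    Measurable fun p : G.Sub × (V → K) =>
      GDeco.mk (G.decoratedComponent hG p.1 (fun x => some (p.2 x)) o) := by
  have := hG.locFin.countable_verts hG.connected
  have := hG.locFin.countable_edges hG.connected
  have := UniformSpace.secondCountable_of_separable K
  have hc : Continuous fun p : ((V → Bool) × (E → Bool)) × (V → K) =>
      GDeco.mk (G.decoratedComponent hG (G.subOf p.1) (fun x => some (p.2 x)) o) := by
    refine continuous_decoratedComponent hG o (χ := fun (c : V → K) x => some (c x))
      fun c x ε hε => ?_
    have : ∀ᶠ c' : V → K in nhds c, dist (c x) (c' x) < ε := by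
      have h := (continuous_apply (A := fun _ : V => K) x).continuousAt.eventually
        (Metric.ball_mem_nhds (c x) hε)
      filter_upwards [h] with c' hc'
      rwa [dist_comm]
    exact this.mono fun c' h => .some h.le
  have := hc.measurable.comp ((measurable_code (G := G)).prodMap (measurable_id (α := V → K)))
  simpa [Function.comp_def, subOf_code] using this

/-- A measurable set of subgraphs which is preserved by the automorphisms moving a vertex of the
component of `o` to `o` is given by an invariant property of the component of `o`. The property
consists of the decorated components of all the subgraphs in the set. It is Borel by the Lusin
separation theorem, as the space of decorated graphs is Hausdorff. -/
theorem exists_invariantProperty [MetricSpace K] (hG : G.IsCayley) (o : V)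
    (htrans : ∀ x, ∃ γ : G.Iso G, γ.onV x = o) {S : Set G.Sub} (hS : MeasurableSet S)
    (hSinv : ∀ (γ : G.Iso G) (ω : G.Sub) (x : V), x ∈ ω.comp o → γ.onV x = o → ω ∈ S →
      γ.mapSub ω ∈ S) :
    ∃ B : Set (GDeco.{u, v} K), GDeco.IsInvariantProperty B ∧
      ∀ ω, GDeco.mk (G.decoratedComponent hG ω (fun _ => none) o) ∈ B ↔ ω ∈ S := by
  have := hG.locFin.countable_verts hG.connected
  have := hG.locFin.countable_edges hG.connected
  set Ψ : G.Sub → GDeco.{u, v} K := fun ω =>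
    GDeco.mk (G.decoratedComponent hG ω (fun _ => none) o) with hΨ
  have hc : Continuous fun z : (V → Bool) × (E → Bool) => Ψ (G.subOf z) := by
    have := continuous_decoratedComponent hG o (Y := Unit) (χ := fun _ _ => none)
      (fun _ _ _ _ => Filter.Eventually.of_forall fun _ => .none)
    exact this.comp (Continuous.prodMk continuous_id continuous_const : Continuous fun z => (z, ()))
  have hmem : ∀ ω, Ψ ω ∈ Ψ '' S ↔ ω ∈ S := by
    refine fun ω => ⟨?_, fun h => ⟨ω, h, rfl⟩⟩
    rintro ⟨ω', hω', h⟩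
    obtain ⟨f, h1, -, -, -, h5, h6⟩ := GDeco.mk_eq_mk.1 h
    change G.Iso G at f
    have : f.mapSub ω' = ω := by
      apply Sub.ext
      · ext x
        obtain ⟨x, rfl⟩ := f.onV.surjective x
        exact (f.mem_mapSub_verts ω').trans (h5 x).symm
      · ext x
        obtain ⟨x, rfl⟩ := f.onE.surjective x
        exact (f.mem_mapSub_edges ω').trans (h6 x).symm
    rw [← this]
    exact hSinv f ω' o (SimpleGraph.Reachable.refl _) h1 hω'
  refine ⟨Ψ '' S, ⟨?_, ?_⟩, hmem⟩
  · have : TopologicalSpace.IsCompletelyMetrizableSpace (V → Bool) := inferInstance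
    have : TopologicalSpace.IsCompletelyMetrizableSpace (E → Bool) := inferInstance
    have himage : ∀ T : Set G.Sub, (fun z => Ψ (G.subOf z)) '' (G.subOf ⁻¹' T) = Ψ '' T := by
      intro T
      rw [show (fun z => Ψ (G.subOf z)) = Ψ ∘ G.subOf from rfl, Set.image_comp,
        Set.image_preimage_eq _ fun ω => ⟨ω.code, subOf_code ω⟩]
    have han : ∀ T : Set G.Sub, MeasurableSet T → AnalyticSet (Ψ '' T) := fun T hT => by
      rw [← himage]
      exact (measurable_subOf hT).analyticSet.image_of_continuous hc
    -- `Ψ '' S` and its complement in the compact range of `Ψ` are disjoint analytic sets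
    obtain ⟨B, hSB, hB, hBm⟩ := (han S hS).measurablySeparable (han Sᶜ hS.compl) (by
      rw [Set.disjoint_left]
      rintro _ h ⟨ω, hω, rfl⟩
      exact hω ((hmem ω).1 h))
    have hrange : MeasurableSet (Set.range Ψ) := by
      rw [← Set.image_univ, ← himage, Set.preimage_univ, Set.image_univ]
      exact (isCompact_range hc).isClosed.measurableSet
    have : Ψ '' S = B ∩ Set.range Ψ := by
      refine Set.Subset.antisymm (Set.subset_inter hSB (Set.image_subset_range _ _)) ?_
      rintro _ ⟨h, ω, rfl⟩
      by_contra hcon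
      exact Set.disjoint_left.1 hB (Set.mem_image_of_mem Ψ fun h' => hcon ((hmem ω).2 h')) h
    rw [this]
    exact hBm.inter hrange
  · rintro D x hx ⟨ω, hω, h⟩
    obtain ⟨x', hx', h'⟩ := (GDeco.mk_eq_mk.1 h).symm.reroot hx
    change x' ∈ ω.comp o at hx'
    obtain ⟨γ, hγ⟩ := htrans x'
    have h2 := equivalent_mapSub hG γ ω (χ := fun _ => none) (χ' := fun _ => none)
      (fun _ => rfl) x'
    rw [hγ] at h2
    exact ⟨γ.mapSub ω, hSinv γ ω x' hx' hγ hω, GDeco.mk_eq_mk.2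
      ((h'.trans (equivalent_reroot hG ω _ hx')).trans h2).symm⟩

end Diagram

/-! ### Mass transport and a zero-one law for invariant events -/

section MassTransport

open scoped ENNReal

variable {H X L : Type*} [Group H] [MeasurableSpace X] [MulAction H X]
  [MeasurableSpace L]

/-- The mass transport principle for an action of a countable group preserving a measure. -/
theorem tsum_lintegral_mass_transport {m : Measure X}
    (hm : ∀ g : H, MeasurePreserving (fun x : X => g • x) m m) {F : X → H → H → ℝ≥0∞}
    (hF : ∀ h k, Measurable fun x => F x h k)
    (hinv : ∀ (g : H) x h k, F (g • x) (g * h) (g * k) = F x h k) :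
    ∑' k, ∫⁻ x, F x 1 k ∂m = ∑' k, ∫⁻ x, F x k 1 ∂m := by
  rw [← (Equiv.inv H).tsum_eq]
  refine tsum_congr fun k => ?_
  rw [← (hm k).lintegral_comp (hF k 1)]
  refine lintegral_congr fun x => ?_
  rw [← hinv k x 1]
  simp

/-- If a group acts by measure preserving maps and `R x` are equivariant equivalence relations on
the group, then almost surely, no infinite class of `R x` has a finite, nonzero number of elements
`k` with `k⁻¹ • x ∈ B`: otherwise, every element of the class could send mass one in total, equally
distributed, to those elements, which would receive an infinite mass. -/
theorem ae_infinite_of_mem [Countable H] {m : Measure X} [IsProbabilityMeasure m]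
    (hm : ∀ g : H, MeasurePreserving (fun x : X => g • x) m m) {R : X → H → H → Prop}
    (hR : ∀ h k, MeasurableSet {x | R x h k}) (hReq : ∀ x, Equivalence (R x))
    (hRinv : ∀ (g : H) x h k, R (g • x) (g * h) (g * k) ↔ R x h k) {B : Set X}
    (hB : MeasurableSet B) :
    ∀ᵐ x ∂m, x ∈ B → {k | R x 1 k}.Infinite → {k | R x 1 k ∧ k⁻¹ • x ∈ B}.Infinite := by
  classical
  set J : X → H → H → ℝ≥0∞ := fun x h k => if R x h k ∧ k⁻¹ • x ∈ B then 1 else 0 with hJ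
  -- `N x h` is the number of elements of the class of `h` that receive mass. If it is infinite, then
  -- its inverse is zero, and no mass is sent.
  set N : X → H → ℝ≥0∞ := fun x h => ∑' k, J x h k with hN
  have hJm : ∀ h k, Measurable fun x => J x h k := fun h k =>
    Measurable.ite ((hR h k).inter ((hm k⁻¹).measurable hB)) measurable_const measurable_const
  have hNm : ∀ h, Measurable fun x => N x h := fun h => Measurable.tsum (hJm h)
  have hJinv : ∀ (g : H) x h k, J (g • x) (g * h) (g * k) = J x h k := by
    intro g x h k
    simp [hJ, hRinv, mul_smul]
  have hNinv : ∀ (g : H) x h, N (g • x) (g * h) = N x h := by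
    intro g x h
    simp only [hN]
    rw [← (Equiv.mulLeft g).tsum_eq]
    exact tsum_congr fun k => hJinv g x h k
  have hNR : ∀ x h, R x h 1 → N x h = N x 1 := by
    intro x h hh
    refine tsum_congr fun k => ?_
    have : R x h k ↔ R x 1 k :=
      ⟨fun h' => (hReq x).trans ((hReq x).symm hh) h', fun h' => (hReq x).trans hh h'⟩
    simp [hJ, this]
  have hmt := tsum_lintegral_mass_transport hm (F := fun x h k => J x h k * (N x h)⁻¹)
    (fun h k => (hJm h k).mul (hNm h).inv) (fun g x h k => by rw [hJinv, hNinv])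
  have hm1 : ∀ k, Measurable fun x => J x 1 k * (N x 1)⁻¹ := fun k => (hJm 1 k).mul (hNm 1).inv
  have hm2 : ∀ k, Measurable fun x => J x k 1 * (N x k)⁻¹ := fun k => (hJm k 1).mul (hNm k).inv
  rw [← lintegral_tsum fun k => (hm1 k).aemeasurable,
    ← lintegral_tsum fun k => (hm2 k).aemeasurable] at hmt
  have hle : ∫⁻ x, ∑' k, J x 1 k * (N x 1)⁻¹ ∂m ≤ 1 := by
    refine (lintegral_mono (g := fun _ => 1) fun x => ?_).trans (by simp)
    rw [ENNReal.tsum_mul_right]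
    exact ENNReal.mul_inv_le_one _
  rw [hmt] at hle
  have hfin := ae_lt_top (Measurable.tsum hm2)
    (ne_top_of_le_ne_top ENNReal.one_ne_top hle)
  filter_upwards [hfin] with x hx hxB hinf
  by_contra hcon
  rw [Set.not_infinite] at hcon
  have hNx : N x 1 ≠ ⊤ := by
    have : N x 1 = ∑ k ∈ hcon.toFinset, J x 1 k := tsum_eq_sum fun k hk => by
      simp only [Set.Finite.mem_toFinset, Set.mem_ofPred_eq] at hk
      simp [hJ, hk]
    rw [this]
    exact ENNReal.sum_ne_top.2 fun k _ => by simp only [hJ]; split_ifs <;> simp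
  refine hx.ne (top_le_iff.1 ?_)
  have : Infinite {k | R x 1 k} := hinf.to_subtype
  calc ⊤ = ∑' _ : {k | R x 1 k}, (N x 1)⁻¹ :=
        (ENNReal.tsum_const_eq_top_of_ne_zero (ENNReal.inv_ne_zero.2 hNx)).symm
    _ = ∑' k : {k | R x 1 k}, J x k 1 * (N x k)⁻¹ := by
        refine tsum_congr fun k => ?_
        have hk : R x k 1 := (hReq x).symm k.2
        rw [hNR x k hk]
        simp [hJ, hk, hxB]
    _ ≤ ∑' k, J x k 1 * (N x k)⁻¹ :=
        ENNReal.tsum_comp_le_tsum_of_injective Subtype.val_injective _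

/-- Events are approximated by events that depend on finitely many labels. -/
theorem exists_cylinder_approx {H X L : Type*} [MeasurableSpace X] [MeasurableSpace L]
    (ρ : Measure (X × (H → L))) [IsFiniteMeasure ρ] {D : Set (X × (H → L))} (hD : MeasurableSet D)
    {ε : ℝ} (hε : 0 < ε) :
    ∃ (F : Finset H) (C : Set (X × (F → L))), MeasurableSet C ∧
      ρ (symmDiff D ((fun p => (p.1, F.restrict p.2)) ⁻¹' C)) < ENNReal.ofReal ε := by
  classical
  have hmeas : ∀ F : Finset H,
      Measurable fun p : X × (H → L) => (p.1, F.restrict (π := fun _ => L) p.2) := fun F =>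
    measurable_fst.prodMk ((Finset.measurable_restrict F).comp measurable_snd)
  set 𝒜 : Set (Set (X × (H → L))) := {s | ∃ (F : Finset H) (C : Set (X × (F → L))),
    MeasurableSet C ∧ s = (fun p => (p.1, F.restrict p.2)) ⁻¹' C} with h𝒜
  have halg : IsSetAlgebra 𝒜 := by
    refine ⟨⟨∅, ∅, .empty, rfl⟩, ?_, ?_⟩
    · rintro _ ⟨F, C, hC, rfl⟩
      exact ⟨F, Cᶜ, hC.compl, rfl⟩
    · rintro _ _ ⟨F, C, hC, rfl⟩ ⟨F', C', hC', rfl⟩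
      have h1 : Measurable fun p : X × ((F ∪ F' : Finset H) → L) =>
          (p.1, Finset.restrict₂ (π := fun _ => L) (Finset.subset_union_left (s₂ := F')) p.2) :=
        measurable_fst.prodMk ((Finset.measurable_restrict₂ _).comp measurable_snd)
      have h2 : Measurable fun p : X × ((F ∪ F' : Finset H) → L) =>
          (p.1, Finset.restrict₂ (π := fun _ => L) (Finset.subset_union_right (s₁ := F)) p.2) :=
        measurable_fst.prodMk ((Finset.measurable_restrict₂ _).comp measurable_snd)
      exact ⟨F ∪ F', _, (h1 hC).union (h2 hC'), rfl⟩
  have hgen : (inferInstance : MeasurableSpace (X × (H → L))) = MeasurableSpace.generateFrom 𝒜 := by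
    refine le_antisymm ?_ (MeasurableSpace.generateFrom_le ?_)
    · have h1 : @Measurable _ _ (MeasurableSpace.generateFrom 𝒜) _
          (Prod.fst : X × (H → L) → X) := fun s hs =>
        MeasurableSpace.measurableSet_generateFrom ⟨∅, Prod.fst ⁻¹' s, measurable_fst hs, rfl⟩
      have h2 : @Measurable _ _ (MeasurableSpace.generateFrom 𝒜) _
          (Prod.snd : X × (H → L) → (H → L)) := by
        refine @measurable_pi_lambda _ _ _ (MeasurableSpace.generateFrom 𝒜) _ _ fun h s hs => ?_
        refine MeasurableSpace.measurableSet_generateFrom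
          ⟨{h}, {p | p.2 ⟨h, Finset.mem_singleton_self h⟩ ∈ s}, ?_, rfl⟩
        exact ((measurable_pi_apply _).comp measurable_snd) hs
      exact sup_le h1.comap_le h2.comap_le
    · rintro _ ⟨F, C, hC, rfl⟩
      exact hmeas F hC
  obtain ⟨_, ⟨F, C, hC, rfl⟩, h⟩ :=
    (Measure.MeasureDense.of_generateFrom_isSetAlgebra_finite (μ := ρ) halg hgen).approx D hD
      (measure_ne_top _ _) ε hε
  exact ⟨F, C, hC, h⟩

/-- An event that is close to two independent events of nearly the same probability has probability
close to zero or one. -/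
theorem measureReal_le_sq_add {Y : Type*} [MeasurableSpace Y] {ν : Measure Y}
    [IsProbabilityMeasure ν] {D C C' : Set Y}
    {η : ℝ} (hη : η ≤ 1) (hC : ν.real (symmDiff D C) ≤ η) (hC' : ν.real (symmDiff D C') ≤ η)
    (hind : ν (C ∩ C') = ν C * ν C') : ν.real D ≤ ν.real D ^ 2 + 5 * η := by
  have hη0 : 0 ≤ η := measureReal_nonneg.trans hC
  have h1 : ∀ {C : Set Y}, ν.real (symmDiff D C) ≤ η → ν.real C ≤ ν.real D + η := by
    intro C hC
    calc ν.real C ≤ ν.real (D ∪ symmDiff D C) := measureReal_mono (by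
          intro x hx
          by_cases h : x ∈ D
          exacts [Or.inl h, Or.inr (Or.inr ⟨hx, h⟩)])
      _ ≤ _ := (measureReal_union_le _ _).trans (by linarith)
  have h2 : ν.real D ≤ ν.real (C ∩ C') + η + η := by
    calc ν.real D ≤ ν.real ((C ∩ C') ∪ symmDiff D C ∪ symmDiff D C') := measureReal_mono (by
          intro x hx
          by_cases h : x ∈ C
          · by_cases h' : x ∈ C'
            exacts [Or.inl (Or.inl ⟨h, h'⟩), Or.inr (Or.inl ⟨hx, h'⟩)]
          · exact Or.inl (Or.inr (Or.inl ⟨hx, h⟩)))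
      _ ≤ ν.real ((C ∩ C') ∪ symmDiff D C) + ν.real (symmDiff D C') := measureReal_union_le _ _
      _ ≤ ν.real (C ∩ C') + ν.real (symmDiff D C) + ν.real (symmDiff D C') := by
          gcongr; exact measureReal_union_le _ _
      _ ≤ _ := by linarith
  have h3 : ν.real (C ∩ C') = ν.real C * ν.real C' := by
    simp only [measureReal_def, hind, ENNReal.toReal_mul]
  have h4 := h1 hC
  have h5 := h1 hC'
  have h6 : ν.real D ≤ 1 := measureReal_le_one
  have h7 : ν.real C * ν.real C' ≤ (ν.real D + η) * (ν.real D + η) :=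
    mul_le_mul h4 h5 measureReal_nonneg (by positivity)
  nlinarith [mul_le_mul_of_nonneg_right h6 hη0]

/-- Let `X` be a probability space with a measure preserving action of a countable group `H`, and
consider an independent iid family of labels of the elements of `H`. Let `R x` be equivariant
equivalence relations on `H`. Given a point `x` for which the class of `1` is infinite, an event
that is not affected by translating any element of this class to `1` has conditional probability
zero or one. -/
theorem ae_zero_or_one [Countable H] {m : Measure X} [IsProbabilityMeasure m]
    (hm : ∀ g : H, MeasurePreserving (fun x : X => g • x) m m) {R : X → H → H → Prop}
    (hR : ∀ h k, MeasurableSet {x | R x h k}) (hReq : ∀ x, Equivalence (R x))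
    (hRinv : ∀ (g : H) x h k, R (g • x) (g * h) (g * k) ↔ R x h k)
    (ν₀ : Measure L) [IsProbabilityMeasure ν₀] {D : Set (X × (H → L))} (hD : MeasurableSet D)
    (hDinv : ∀ x l k, R x 1 k → ((k⁻¹ • x, fun j => l (k * j)) ∈ D ↔ (x, l) ∈ D)) :
    ∀ᵐ x ∂m, {k | R x 1 k}.Infinite →
      Measure.infinitePi (fun _ : H => ν₀) {l | (x, l) ∈ D} = 0 ∨
      Measure.infinitePi (fun _ : H => ν₀) {l | (x, l) ∈ D} = 1 := by
  classical
  set ν := Measure.infinitePi (fun _ : H => ν₀) with hν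
  -- the labels are invariant under translations
  have hshift : ∀ k : H, MeasurePreserving (fun (l : H → L) j => l (k * j)) ν ν := by
    intro k
    exact ⟨measurable_pi_lambda _ fun j => measurable_pi_apply _,
      Measure.map_infinitePi_infinitePi_of_inj (P := fun _ : H => ν₀) (mul_right_injective k)⟩
  suffices key : ∀ n : ℕ, ∀ᵐ x ∂m, {k | R x 1 k}.Infinite →
      ν.real {l | (x, l) ∈ D} ≤ ν.real {l | (x, l) ∈ D} ^ 2 + 1 / ((n : ℝ) + 1) by
    filter_upwards [ae_all_iff.2 key] with x hx hinf
    set p := ν.real {l | (x, l) ∈ D} with hp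
    have h1 : p ≤ p ^ 2 := by
      have := ge_of_tendsto' ((tendsto_one_div_add_atTop_nhds_zero_nat (𝕜 := ℝ)).const_add (p ^ 2))
        fun n => hx n hinf
      simpa using this
    have h0 : 0 ≤ p := measureReal_nonneg
    have h2 : p ≤ 1 := measureReal_le_one
    have h3 : p * (1 - p) = 0 := le_antisymm (by nlinarith) (mul_nonneg h0 (by linarith))
    rcases mul_eq_zero.1 h3 with h | h
    · left
      exact (measureReal_eq_zero_iff).1 h
    · right
      have h4 : (ν {l | (x, l) ∈ D}).toReal = 1 := by
        change p = 1
        linarith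
      exact (ENNReal.toReal_eq_one_iff _).1 h4
  intro n
  set c : ℝ := 1 / ((n : ℝ) + 1) with hc
  have hc0 : 0 < c := by positivity
  have hc1 : c ≤ 1 := by rw [hc, div_le_one (by positivity)]; linarith [n.cast_nonneg (α := ℝ)]
  suffices step : ∀ η : ℝ, 0 < η → 5 * η ≤ c →
      m {x | ¬({k | R x 1 k}.Infinite →
        ν.real {l | (x, l) ∈ D} ≤ ν.real {l | (x, l) ∈ D} ^ 2 + c)} ≤ ENNReal.ofReal η by
    have hlim : Filter.Tendsto (fun j : ℕ => ENNReal.ofReal (c / 5 * (1 / ((j : ℝ) + 1))))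
        Filter.atTop (nhds 0) := by
      have := ENNReal.tendsto_ofReal
        ((tendsto_one_div_add_atTop_nhds_zero_nat (𝕜 := ℝ)).const_mul (c / 5))
      simpa using this
    refine ae_iff.2 (le_antisymm (ge_of_tendsto' hlim fun j => step _ (by positivity) ?_) zero_le)
    have : 1 / ((j : ℝ) + 1) ≤ 1 := by
      rw [div_le_one (by positivity)]; linarith [j.cast_nonneg (α := ℝ)]
    nlinarith
  intro η hη hηc
  obtain ⟨F, C, hC, hlt⟩ := exists_cylinder_approx (m.prod ν) hD (mul_pos hη hη)
  set S := symmDiff D ((fun p : X × (H → L) => (p.1, F.restrict (π := fun _ => L) p.2)) ⁻¹' C)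
    with hS
  have hSm : MeasurableSet S := hD.symmDiff
    ((measurable_fst.prodMk ((Finset.measurable_restrict F).comp measurable_snd)) hC)
  have ham : Measurable fun x => ν (Prod.mk x ⁻¹' S) := measurable_measure_prodMk_left hSm
  set B : Set X := {x | ν (Prod.mk x ⁻¹' S) < ENNReal.ofReal η} with hB
  have hBm : MeasurableSet B := measurableSet_lt ham measurable_const
  have hBc : m Bᶜ ≤ ENNReal.ofReal η := by
    have h1 := mul_meas_ge_le_lintegral (μ := m) ham (ENNReal.ofReal η)
    rw [← Measure.prod_apply hSm] at h1
    have h2 := h1.trans hlt.le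
    rw [ENNReal.ofReal_mul hη.le, ENNReal.mul_le_mul_iff_right
      (by simpa using hη) ENNReal.ofReal_ne_top] at h2
    refine le_trans (measure_mono fun x hx => ?_) h2
    exact not_lt.1 (show ¬ν (Prod.mk x ⁻¹' S) < ENNReal.ofReal η from hx)
  refine le_trans (measure_mono_ae ?_) hBc
  filter_upwards [ae_infinite_of_mem hm hR hReq hRinv hBm] with x hx
  intro hcon hxB
  refine hcon fun hinf => ?_
  -- a translate by `k` of the set `F` of relevant labels that is disjoint from `F`
  obtain ⟨k, ⟨hRk, hkB⟩, hkF⟩ :=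
    (hx hxB hinf).exists_notMem_finset (Finset.image (fun p : H × H => p.1 * p.2⁻¹) (F ×ˢ F))
  have hdisj : Disjoint F (F.image (k * ·)) := by
    rw [Finset.disjoint_left]
    intro j hj hj'
    obtain ⟨i, hi, rfl⟩ := Finset.mem_image.1 hj'
    exact hkF (Finset.mem_image.2 ⟨(k * i, i), Finset.mem_product.2 ⟨hj, hi⟩, by simp⟩)
  have toReal_le : ∀ {y}, y ∈ B → ν.real (Prod.mk y ⁻¹' S) ≤ η := fun hy =>
    ENNReal.toReal_le_of_le_ofReal hη.le (le_of_lt hy)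
  set C₁ : Set (H → L) := {l | (x, F.restrict l) ∈ C} with hC₁
  set C₂ : Set (H → L) := {l | (k⁻¹ • x, F.restrict fun j => l (k * j)) ∈ C} with hC₂
  have hd : ν.real (symmDiff {l | (x, l) ∈ D} C₁) ≤ η := toReal_le hxB
  have hd' : ν.real (symmDiff {l | (x, l) ∈ D} C₂) ≤ η := by
    have : symmDiff {l | (x, l) ∈ D} C₂ =
        (fun (l : H → L) j => l (k * j)) ⁻¹' (Prod.mk (k⁻¹ • x) ⁻¹' S) := by
      have h : {l | (x, l) ∈ D} = {l | (k⁻¹ • x, fun j => l (k * j)) ∈ D} :=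
        Set.ext fun l => (hDinv x l k hRk).symm
      rw [h]
      rfl
    rw [this, measureReal_def,
      (hshift k).measure_preimage (measurable_prodMk_left hSm).nullMeasurableSet]
    exact toReal_le hkB
  have hind : ν (C₁ ∩ C₂) = ν C₁ * ν C₂ := by
    have hi : iIndepFun (fun (i : H) (l : H → L) => l i) ν :=
      iIndepFun_infinitePi (P := fun _ : H => ν₀) (X := fun _ l => l) fun _ => measurable_id
    have hi' := hi.indepFun_finset F (F.image (k * ·)) hdisj fun i => measurable_pi_apply i
    refine hi'.measure_inter_preimage_eq_mul (Prod.mk x ⁻¹' C)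
      {u | (k⁻¹ • x, fun j : F => u ⟨k * j, Finset.mem_image_of_mem _ j.2⟩) ∈ C}
      (measurable_prodMk_left hC) ?_
    exact (measurable_const.prodMk (measurable_pi_lambda _ fun j => measurable_pi_apply _)) hC
  have := measureReal_le_sq_add (by linarith) hd hd' hind
  linarith

end MassTransport

/-! ### Translations of Cayley graphs and diagrams -/

namespace Diagram

variable {V E : Type u} {K : Type v} {G : Diagram V E K} {o x y : V}

theorem exists_map_mul_eq {H : Type u} [Group H] {S : Finset H} (h : H) {e : Sym2 H}
    (he : ∃ x, ∃ s ∈ S, e = s(x, x * s)) :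
    ∃ x, ∃ s ∈ S, Sym2.map (h * ·) e = s(x, x * s) := by
  obtain ⟨x, s, hs, rfl⟩ := he
  exact ⟨h * x, s, hs, by simp [mul_assoc]⟩

/-- Left translation by `h`, as an automorphism of the Cayley graph. -/
def translateGraph {H : Type u} [Group H] (S : Finset H) (K : Type v) (h : H) :
    (cayleyGraph H S K).Iso (cayleyGraph H S K) where
  onV := Equiv.mulLeft h
  onE :=
    { toFun := fun e => ⟨Sym2.map (h * ·) e.1, exists_map_mul_eq h e.2⟩
      invFun := fun e => ⟨Sym2.map (h⁻¹ * ·) e.1, exists_map_mul_eq h⁻¹ e.2⟩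
      left_inv := fun e => Subtype.ext (by simp [Sym2.map_map])
      right_inv := fun e => Subtype.ext (by simp [Sym2.map_map]) }
  arc e x y := by
    change s(h * x, h * y) = Sym2.map (h * ·) e.1 ↔ s(x, y) = e.1
    rw [← Sym2.map_mk]
    exact (Sym2.map.injective (mul_right_injective h)).eq_iff
  ecol _ := rfl

/-- Left translation by `h`, as an automorphism of the Cayley diagram. -/
def translateDiagram {H : Type u} [Group H] {S : Finset H} (c : S ↪ K) (h : H) :
    (cayleyDiagram H S c).Iso (cayleyDiagram H S c) where
  onV := Equiv.mulLeft h
  onE := (Equiv.mulLeft h).prodCongr (Equiv.refl S)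
  arc e x y := by simp [cayleyDiagram, mul_assoc]
  ecol _ := rfl

theorem Iso.mapSub_eq_of_onE {γ γ' γ'' : G.Iso G} (hV : ∀ x, γ.onV x = γ'.onV (γ''.onV x))
    (hE : ∀ e, γ.onE e = γ'.onE (γ''.onE e)) (ω : G.Sub) :
    γ.mapSub ω = γ'.mapSub (γ''.mapSub ω) := by
  apply Sub.ext
  · change γ.onV '' ω.verts = γ'.onV '' (γ''.onV '' ω.verts)
    rw [← Set.image_comp]
    exact Set.image_congr fun x _ => hV x
  · change γ.onE '' ω.edges = γ'.onE '' (γ''.onE '' ω.edges)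
    rw [← Set.image_comp]
    exact Set.image_congr fun x _ => hE x

/-- A Cayley graph or diagram has a group of automorphisms which acts simply transitively on the
vertices. -/
theorem IsCayley.exists_translations (hG : G.IsCayley) (o : V) :
    ∃ (H : Type u) (_ : Group H) (φ : H ≃ V) (γ : H → G.Iso G), φ 1 = o ∧
      (∀ h k, (γ h).onV (φ k) = φ (h * k)) ∧ (∀ ω, (γ 1).mapSub ω = ω) ∧
      ∀ h k ω, (γ (h * k)).mapSub ω = (γ h).mapSub ((γ k).mapSub ω) := by
  have key : ∀ {H : Type u} [Group H] {E' : Type u} {G' : Diagram H E' K} (f : G.Iso G')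
      (T : H → G'.Iso G'), (∀ h, (T h).onV = Equiv.mulLeft h) →
      (∀ h k e, (T (h * k)).onE e = (T h).onE ((T k).onE e)) →
      ∃ (φ : H ≃ V) (γ : H → G.Iso G), φ 1 = o ∧
      (∀ h k, (γ h).onV (φ k) = φ (h * k)) ∧ (∀ ω, (γ 1).mapSub ω = ω) ∧
      ∀ h k ω, (γ (h * k)).mapSub ω = (γ h).mapSub ((γ k).mapSub ω) := by
    intro H _ E' G' f T hV hE
    have hmul : ∀ h k ω, ((f.trans (T (h * k))).trans f.symm).mapSub ω =
        ((f.trans (T h)).trans f.symm).mapSub (((f.trans (T k)).trans f.symm).mapSub ω) :=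
      fun h k ω => Iso.mapSub_eq_of_onE (by simp [Iso.trans, Iso.symm, hV])
        (by simp [Iso.trans, Iso.symm, hE]) ω
    refine ⟨(Equiv.mulRight (f.onV o)).trans f.onV.symm, fun h => (f.trans (T h)).trans f.symm,
      by simp, fun h k => by simp [Iso.trans, Iso.symm, hV, mul_assoc], fun ω => ?_, hmul⟩
    have hinj : Function.Injective ((f.trans (T 1)).trans f.symm).mapSub := fun ω ω' h => Sub.ext
      (Set.image_injective.2 (Equiv.injective _) (congrArg Sub.verts h))
      (Set.image_injective.2 (Equiv.injective _) (congrArg Sub.edges h))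
    exact hinj (by rw [← hmul, mul_one])
  obtain ⟨H, _, S, -, ⟨⟨f⟩⟩ | ⟨c, ⟨f⟩⟩⟩ := hG
  · obtain ⟨φ, γ, h⟩ := key f (translateGraph S K) (fun _ => rfl) fun h k e => by
      refine Subtype.ext ?_
      change Sym2.map (h * k * ·) e.1 = Sym2.map (h * ·) (Sym2.map (k * ·) e.1)
      rw [Sym2.map_map]
      congr 1
      ext x
      simp [mul_assoc]
    exact ⟨H, _, φ, γ, h⟩
  · obtain ⟨φ, γ, h⟩ := key f (translateDiagram c) (fun _ => rfl) fun h k e => by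
      exact Prod.ext (mul_assoc h k e.1) rfl
    exact ⟨H, _, φ, γ, h⟩

theorem skel_mono {F F' : Set E} (h : F ⊆ F') : G.skel F ≤ G.skel F' := by
  intro a b hab
  rw [skel, SimpleGraph.fromRel_adj] at hab ⊢
  exact ⟨hab.1, hab.2.imp (fun ⟨e, he, h'⟩ => ⟨e, h he, h'⟩) fun ⟨e, he, h'⟩ => ⟨e, h he, h'⟩⟩

theorem exists_finset_reachable {F : Set E} (h : (G.skel F).Reachable x y) :
    ∃ S : Finset E, (S : Set E) ⊆ F ∧ (G.skel S).Reachable x y := by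
  classical
  obtain ⟨p⟩ := h
  induction p with
  | nil => exact ⟨∅, by simp, SimpleGraph.Reachable.refl _⟩
  | cons hadj _ ih =>
    obtain ⟨S, hS, hr⟩ := ih
    rw [skel, SimpleGraph.fromRel_adj] at hadj
    obtain ⟨e, he, h⟩ : ∃ e ∈ F, G.Arc e _ _ ∨ G.Arc e _ _ := by
      obtain ⟨e, he, h⟩ | ⟨e, he, h⟩ := hadj.2
      exacts [⟨e, he, Or.inl h⟩, ⟨e, he, Or.inr h⟩]
    refine ⟨insert e S, by simp [Set.insert_subset_iff, he, hS], ?_⟩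
    refine SimpleGraph.Reachable.trans (SimpleGraph.Adj.reachable ?_)
      (hr.mono (skel_mono (by simp)))
    rw [skel, SimpleGraph.fromRel_adj]
    exact ⟨hadj.1, h.imp (fun h => ⟨e, by simp, h⟩) fun h => ⟨e, by simp, h⟩⟩

theorem measurableSet_mem_comp [Countable E] (x y : V) :
    MeasurableSet {ω : G.Sub | y ∈ ω.comp x} := by
  have : {ω : G.Sub | y ∈ ω.comp x} =
      ⋃ S : Finset E, ⋃ _ : (G.skel S).Reachable x y, ⋂ e ∈ S, {ω : G.Sub | e ∈ ω.edges} := by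
    ext ω
    simp only [Set.mem_ofPred_eq, Set.mem_iUnion, Set.mem_iInter, exists_prop]
    constructor
    · intro h
      obtain ⟨S, hS, hr⟩ := exists_finset_reachable h
      exact ⟨S, hr, fun e he => hS he⟩
    · rintro ⟨S, hr, hS⟩
      exact hr.mono (skel_mono fun e he => hS e he)
  rw [this]
  exact .iUnion fun S => .iUnion fun _ => .biInter S.countable_toSet fun e _ =>
    measurableSet_mem_edges e

end Diagram

/-! ### Invariant properties of components decorated with a factor of iid -/

theorem lemma2p7 {V E : Type u} {K : Type v} [MetricSpace K] [TopologicalSpace.SeparableSpace K]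
    [MeasurableSpace K] [BorelSpace K]
    (G : Diagram V E K) (hG : G.IsCayley) (o : V)
    {Ω : Type w} [MeasurableSpace Ω] (μ : Measure Ω) [IsProbabilityMeasure μ]
    (ω : Ω → G.Sub) (hω : Measurable ω)
    (hinv : ∀ γ : G.Iso G, μ.map (fun t => γ.mapSub (ω t)) = μ.map ω)
    (lam : Ω → V → unitInterval) (hlam : ∀ x, Measurable fun t => lam t x)
    (hunif : ∀ x, μ.map (fun t => lam t x) = volume)
    (hiid : iIndepFun (fun x t => lam t x) μ)
    (hind : IndepFun ω lam μ)
    (δ : G.Sub → (V → unitInterval) → V → K) (hδ : G.IsFactorOfIID δ)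
    (hinf : ∀ᵐ t ∂μ, ∀ x ∈ (ω t).verts, ((ω t).comp x).Infinite)
    (hindist : G.Indistinguishable hG μ o ω (fun _ _ => none)) :
    G.Indistinguishable hG μ o ω (fun t x => some (δ (ω t) (lam t) x)) := by
  intro A hA
  have := hG.locFin.countable_verts hG.connected
  have := hG.locFin.countable_edges hG.connected
  obtain ⟨H, _, φ, γ, hφ, hγφ, hγ1, hγmul⟩ := hG.exists_translations o
  have : Countable H := φ.countable_iff.2 inferInstance
  let _ : MulAction H G.Sub :=
    { smul := fun h ω => (γ h).mapSub ω
      one_smul := hγ1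
      mul_smul := hγmul }
  set m : Measure G.Sub := μ.map ω with hm
  have : IsProbabilityMeasure (μ.map ω) := Measure.isProbabilityMeasure_map hω.aemeasurable
  have hmp : ∀ g : H, MeasurePreserving (fun x : G.Sub => g • x) m m := fun g =>
    ⟨Diagram.measurable_mapSub (γ g),
      (Measure.map_map (Diagram.measurable_mapSub (γ g)) hω).trans (hinv (γ g))⟩
  -- the labels, indexed by the group
  set lam' : Ω → H → unitInterval := fun t h => lam t (φ h) with hlam'
  have hlam'm : Measurable lam' := measurable_pi_lambda _ fun h => hlam (φ h)
  set ν : Measure (H → unitInterval) := Measure.infinitePi fun _ => volume with hν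
  have hlaw : μ.map lam' = ν := by
    have h := (hiid.precomp φ.injective).map_fun_eq_infinitePi_map fun h => hlam (φ h)
    simp only [hunif] at h
    exact h
  have hjoint : μ.map (fun t => (ω t, lam' t)) = m.prod ν := by
    have h : IndepFun ω lam' μ := hind.comp (φ := id) (ψ := fun (l : V → unitInterval) h => l (φ h))
      measurable_id (measurable_pi_lambda _ fun h => measurable_pi_apply _)
    rw [(indepFun_iff_map_prod_eq_prod_map_map hω.aemeasurable hlam'm.aemeasurable).1 h, hlaw]
  -- the event that the decorated component of `x` is in `A`
  set D : V → Set (G.Sub × (H → unitInterval)) := fun x =>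
    {p | GDeco.mk (G.decoratedComponent hG p.1 (fun y => some (δ p.1 (p.2 ∘ φ.symm) y)) x) ∈ A} with hD
  have hDm : ∀ x, MeasurableSet (D x) := fun x => by
    have h1 : Measurable fun p : G.Sub × (H → unitInterval) => (p.1, p.2 ∘ φ.symm) :=
      measurable_fst.prodMk (measurable_pi_lambda _ fun y =>
        (measurable_pi_apply _).comp measurable_snd)
    exact (Diagram.measurable_decoratedComponent hG x).comp (measurable_fst.prodMk
      (measurable_pi_lambda _ fun y => (hδ.measurable y).comp h1)) hA.1
  -- within a component, the root does not matter
  have hDroot : ∀ (w : G.Sub) l x, x ∈ w.comp o → ((w, l) ∈ D x ↔ (w, l) ∈ D o) :=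
    fun w l x hx => Diagram.mem_iff_of_mem_comp hG hA w _ hx
  -- equivariance under all automorphisms
  have hDiso : ∀ (f : G.Iso G) (w : G.Sub) (l l' : H → unitInterval) x,
      l' ∘ φ.symm = (l ∘ φ.symm) ∘ f.onV.symm →
      ((f.mapSub w, l') ∈ D (f.onV x) ↔ (w, l) ∈ D x) := by
    intro f w l l' x hl
    have h := Diagram.equivalent_mapSub hG f w (χ := fun y => some (δ w (l ∘ φ.symm) y))
      (χ' := fun y => some (δ (f.mapSub w) (l' ∘ φ.symm) y))
      (fun y => by rw [hl, hδ.equivariant]) x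
    simp only [hD, Set.mem_ofPred_eq, GDeco.mk_eq_mk.2 h]
  have hγo : ∀ k, (γ k).onV o = φ k := fun k => by rw [← hφ, hγφ, mul_one]
  have hR : ∀ (g : H) (w : G.Sub) h k,
      φ (g * k) ∈ (g • w).comp (φ (g * h)) ↔ φ k ∈ w.comp (φ h) := fun g w h k => by
    rw [← hγφ, ← hγφ]
    exact (γ g).mem_mapSub_comp w
  have h01 := ae_zero_or_one hmp (R := fun (w : G.Sub) h k => φ k ∈ w.comp (φ h))
    (fun h k => Diagram.measurableSet_mem_comp _ _)
    (fun w => ⟨fun _ => SimpleGraph.Reachable.refl _, SimpleGraph.Reachable.symm,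
      SimpleGraph.Reachable.trans⟩) hR volume (hDm o) (fun w l k hk => by
      rw [hφ] at hk
      rw [← hDroot w l _ hk, ← hDiso (γ k) (k⁻¹ • w) (fun j => l (k * j)) l o ?_, hγo,
        show (γ k).mapSub (k⁻¹ • w) = w from smul_inv_smul k w]
      funext x
      obtain ⟨j, rfl⟩ := φ.surjective x
      have : (γ k).onV.symm (φ j) = φ (k⁻¹ * j) := by
        rw [Equiv.symm_apply_eq, hγφ, mul_inv_cancel_left]
      simp [this])
  -- the property that the conditional probability of `A` given `ω` is one
  have hpm : Measurable fun w : G.Sub => ν {l | (w, l) ∈ D o} :=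
    measurable_measure_prodMk_left (hDm o)
  have htrans : ∀ x, ∃ f : G.Iso G, f.onV x = o := fun x => by
    refine ⟨γ (φ.symm x)⁻¹, ?_⟩
    rw [← hφ, ← inv_mul_cancel (φ.symm x), ← hγφ, φ.apply_symm_apply]
  have hS : ∀ (f : G.Iso G) (w : G.Sub) (x : V), x ∈ w.comp o → f.onV x = o →
      ν {l | (w, l) ∈ D o} = 1 → ν {l | (f.mapSub w, l) ∈ D o} = 1 := by
    intro f w x hx hfx hw
    -- `f` induces a permutation of the labels, which preserves their law
    let σ : H → H := fun j => φ.symm (f.onV (φ j))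
    have hσ : Function.Injective σ := φ.symm.injective.comp (f.onV.injective.comp φ.injective)
    have hperm : MeasurePreserving (fun (l : H → unitInterval) j => l (σ j)) ν ν :=
      ⟨measurable_pi_lambda _ fun j => measurable_pi_apply _,
        Measure.map_infinitePi_infinitePi_of_inj (P := fun _ : H => volume) hσ⟩
    have hset : {l | (f.mapSub w, l) ∈ D o} =
        (fun (l : H → unitInterval) j => l (σ j)) ⁻¹' {l | (w, l) ∈ D o} := by
      ext l
      have := hDiso f w (fun j => l (σ j)) l x (by funext y; simp [σ])
      rw [hfx] at this
      exact this.trans (hDroot w _ x hx)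
    have hwm : MeasurableSet {l | (w, l) ∈ D o} := measurable_prodMk_left (hDm o)
    rw [hset, hperm.measure_preimage hwm.nullMeasurableSet]
    exact hw
  obtain ⟨B, hB, hBmem⟩ := Diagram.exists_invariantProperty (K := K) hG o htrans
    (hpm (measurableSet_singleton 1)) hS
  have hcongr : ∀ t, ((ω t, lam' t) ∈ D o ↔ GDeco.mk (G.decoratedComponent hG (ω t)
      (fun x => some (δ (ω t) (lam t) x)) o) ∈ A) := fun t => by
    have : lam' t ∘ φ.symm = lam t := by funext x; simp [hlam']
    simp only [hD, Set.mem_ofPred_eq, this]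
  have hpair : Measurable fun t => (ω t, lam' t) := hω.prodMk hlam'm
  have h01' : ∀ᵐ t ∂μ, o ∈ (ω t).verts →
      ν {l | (ω t, l) ∈ D o} = 0 ∨ ν {l | (ω t, l) ∈ D o} = 1 := by
    filter_upwards [ae_of_ae_map hω.aemeasurable h01, hinf] with t ht hinf ho
    refine ht ?_
    have h : ((ω t).comp o).Infinite := hinf o ho
    rw [hφ]
    exact h.preimage (f := φ) (by simp [φ.surjective.range_eq])
  -- by Fubini, an event of conditional probability zero given `ω` is null
  have transfer : ∀ P : Set (G.Sub × (H → unitInterval)), MeasurableSet P →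
      (∀ᵐ t ∂μ, ν {l | (ω t, l) ∈ P} = 0) → ∀ᵐ t ∂μ, (ω t, lam' t) ∉ P := by
    intro P hP h
    have h1 : ∀ᵐ w ∂m, ν (Prod.mk w ⁻¹' P) = 0 :=
      (ae_map_iff hω.aemeasurable
        (measurable_measure_prodMk_left hP (measurableSet_singleton 0))).2 h
    have h2 : μ.map (fun t => (ω t, lam' t)) P = 0 := by
      rw [hjoint, Measure.measure_prod_null hP]
      exact h1
    rw [Measure.map_apply hpair hP] at h2
    exact measure_eq_zero_iff_ae_notMem.1 h2
  have hvm : MeasurableSet {p : G.Sub × (H → unitInterval) | o ∈ p.1.verts} :=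
    measurable_fst (Diagram.measurableSet_mem_verts o)
  refine (hindist B hB).imp (fun h => ?_) fun h => ?_
  · have := transfer ({p | o ∈ p.1.verts} ∩ (D o)ᶜ) (hvm.inter (hDm o).compl) (by
      filter_upwards [h] with t ht
      by_cases ho : o ∈ (ω t).verts
      · have h1 := (hBmem _).1 (ht ho)
        refine measure_mono_null (t := {l | (ω t, l) ∈ D o}ᶜ) (fun l hl => hl.2) ?_
        exact (prob_compl_eq_zero_iff (measurable_prodMk_left (hDm o))).2 h1
      · simp [ho])
    filter_upwards [this] with t ht ho
    rw [← hcongr]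
    by_contra hcon
    exact ht ⟨ho, hcon⟩
  · have := transfer ({p | o ∈ p.1.verts} ∩ D o) (hvm.inter (hDm o)) (by
      filter_upwards [h, h01'] with t ht h01
      by_cases ho : o ∈ (ω t).verts
      · rcases h01 ho with h0 | h1
        · exact measure_mono_null (fun l hl => hl.2) h0
        · exact absurd ((hBmem _).2 h1) (ht ho)
      · simp [ho])
    filter_upwards [this] with t ht ho
    rw [← hcongr]
    exact fun hcon => ht ⟨ho, hcon⟩
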